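/- **Setting.** Let $m_Q,m_r,L_r,L_c,g>0$, let $e_3$ be the upward unit vector of $\mathbb R^3$, $\hat a b=a\times b$, and $I_r=\tfrac23 m_rL_r$. The state consists of $x_r,v_r\in\mathbb R^3$ and of unit vectors $q_r,q_1,q_2$ with angular velocities $\omega_r\perp q_r$, $\omega_1\perp q_1$, $\omega_2\perp q_2$. Consider the disturbed reduced dynamics ($j=1,2$) $$\dot x_r=v_r,\qquad m_r(\dot v_r+ge_3)=\mu_1+\mu_2+\Delta x_r,$$ $$\dot q_r=\omega_r\times q_r,\qquad I_r\,\dot\omega_r=q_r\times(\mu_2-\mu_1)+\Delta q_r,$$ $$\dot q_j=\omega_j\times q_j,\qquad m_QL_c\,\dot\omega_j=m_Q\,q_j\times(\ddot x_r+(-1)^jL_r\ddot q_r+ge_3)-q_j\times u_j+\Delta q_j,$$ with disturbances that are bounded by given constants: $\|\Delta x_r\|\le\delta x_r$, $\|\Delta q_r\|\le\delta q_r$, $\|\Delta q_j\|\le\delta q_j$. **Reference.** The desired position $\tilde x_r$ and attitude $\tilde q_r$ with $\|\tilde q_r\|=1$ are $C^4$. Put $\tilde v_r=\dot{\tilde x}_r$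 and $\tilde\omega_r=\tilde q_r\times\dot{\tilde q}_r$, and suppose that $\dot{\tilde v}_r,\ddot{\tilde v}_r,\tilde\omega_r,\dot{\tilde\omega}_r,\ddot{\tilde\omega}_r$ are bounded on $[0,\infty)$. **Control law.** Let $e_{x_r}=x_r-\tilde x_r$, $e_{v_r}=v_r-\tilde v_r$ and, for $i\in\{r,1,2\}$, $e_{q_i}=\tilde q_i\times q_i$, $e_{\omega_i}=\omega_i+\hat q_i^2\tilde\omega_i$, $\Psi_i=1-\tilde q_i^Tq_i$. With positive gains, $\tilde\mu_1,\tilde\mu_2$ are given by $$\tilde\mu_1+\tilde\mu_2=m_r(\dot{\tilde v}_r+ge_3-k_{v_r}e_{v_r}-k_{x_r}e_{x_r}),$$ $$\tilde\mu_2-\tilde\mu_1=I_r\big[-\hat q_r\dot{\tilde\omega}_r+(q_r^T\tilde\omega_r)\hat q_r^2\tilde\omega_r-(q_r^T\tilde\omega_r)e_{\omega_r}+k_{\omega_r}\hat q_re_{\omega_r}+k_{q_r}\hat q_re_{q_r}\big],$$ and $\mu_j=(I+\hat q_j^2)\tilde\mu_j$, $\tilde q_j=-\tilde\mu_j/\|\tilde\mu_j\|$,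 $\tilde\omega_j=\tilde q_j\times\dot{\tilde q}_j$ (time derivatives along the motion). The thrust is $u_j=u_j^{\parallel}+u_j^{\perp}$, where, with $w^{\parallel_j}=(w^Tq_j)q_j$, $$u_j^{\parallel}=\mu_j+m_Q\big(\ddot x_r^{\parallel_j}+ge_3^{\parallel_j}+L_c\|\omega_j\|^2q_j+(-1)^jL_r\ddot q_r^{\parallel_j}\big),$$ $$u_j^{\perp}=-m_Q\hat q_j^2\big[\ddot x_r+(-1)^jL_r\ddot q_r+ge_3+L_c\hat q_j\dot{\tilde\omega}_j-L_c(q_j^T\tilde\omega_j)\omega_j\big]-m_QL_c\hat q_j\big[k_{q_j}e_{q_j}+k_{\omega_j}e_{\omega_j}\big].$$ A solution on an interval is a differentiable state curve satisfying these equations there, with $\tilde\mu_1,\tilde\mu_2\ne0$ and $\tilde\omega_1,\tilde\omega_2$ differentiable, so that the control law is defined. **Domain.** Fix $\bar e_{x_r},\bar e_{v_r},\bar e_{\omega_r},\bar e_{\omega_1},\bar e_{\omega_2}>0$ and $\psi_r\in(0,1)$. For $\psi_1,\psi_2\in(0,1)$ let $\mathcal D$ be the set of errors with $\|e_{x_r}\|\le\bar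 e_{x_r}$, $\|e_{v_r}\|\le\bar e_{v_r}$, $\|e_{\omega_i}\|\le\bar e_{\omega_i}$ and $\Psi_i\le\psi_i$ for $i\in\{r,1,2\}$, and let $\alpha=2\max_{j=1,2}\sqrt{\psi_j(2-\psi_j)}$. **Theorem.** For all the data above (other than $\psi_1,\psi_2$) there is $\alpha_{\max}>0$ such that for all $\psi_1,\psi_2\in(0,1)$ with $\alpha<\alpha_{\max}$ and every $b>0$ there are rod gains $k_{x_r},k_{v_r},k_{q_r},k_{\omega_r}>0$ such that for every $m_0>0$ there are cable gains $k_{q_1},k_{\omega_1},k_{q_2},k_{\omega_2}>0$ for which the tracking errors are uniformly ultimately bounded with ultimate bound $b$: there is $T\ge0$ such that for all $0\le t_0\le t_1$, all disturbances within the given bounds and every solution on $[t_0,t_1]$ that starts in $\mathcal D$ at time $t_0$ and satisfies $\|\tilde\mu_j(t)\|\ge m_0$ for $j=1,2$ and $t\in[t_0,t_1]$, $$\big\|\big(e_{x_r},e_{v_r},e_{q_r},e_{\omega_r},e_{q_1},e_{\omega_1},e_{q_2},e_{\omega_2}\big)(t)\big\|\le b\qquad\text{for all } t\in[t_0+T,t_1].$$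 -/

import Mathlib

noncomputable section

namespace RodTransport

open scoped InnerProductSpace

/-- Euclidean three-space. -/
abbrev E3 := EuclideanSpace ℝ (Fin 3)

/-- The cross product on Euclidean three-space; `cross q` is the hat map of `q`. -/
def cross (a b : E3) : E3 := WithLp.toLp 2 (crossProduct a.ofLp b.ofLp)

/-- The upward unit vector of the inertial frame. -/
def e3 : E3 := EuclideanSpace.single 2 1

/-- The component of `w` parallel to the unit vector `q`. -/
def par (q w : E3) : E3 := (⟪w, q⟫_ℝ) • q

/-- The sign `(-1) ^ j` for the cables `j = 1, 2`, which are indexed here by `0, 1 : Fin 2`. -/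
def sgn (j : Fin 2) : ℝ := if j = 0 then -1 else 1

/-- Physical constants: mass of a quadrotor, mass and half length of the rod, length of the cables,
gravitational acceleration. -/
structure Params where
  mQ : ℝ
  mr : ℝ
  Lr : ℝ
  Lc : ℝ
  g : ℝ
  mQ_pos : 0 < mQ
  mr_pos : 0 < mr
  Lr_pos : 0 < Lr
  Lc_pos : 0 < Lc
  g_pos : 0 < g

/-- Gains of the rod position and rod attitude loops. -/
structure RodGains where
  kx : ℝ
  kv : ℝ
  kq : ℝ
  kω : ℝ
  kx_pos : 0 < kx
  kv_pos : 0 < kv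
  kq_pos : 0 < kq
  kω_pos : 0 < kω

/-- Gains of the two cable attitude loops. -/
structure CableGains where
  kq : Fin 2 → ℝ
  kω : Fin 2 → ℝ
  kq_pos : ∀ j, 0 < kq j
  kω_pos : ∀ j, 0 < kω j

/-- Desired velocity of the rod for the desired position `xd`. -/
def velDes (xd : ℝ → E3) : ℝ → E3 := deriv xd

/-- Angular velocity of a curve `qd` on the unit sphere: the unique `w` with
`deriv qd = cross w qd` and `w` orthogonal to `qd`. -/
def angVel (qd : ℝ → E3) (t : ℝ) : E3 := cross (qd t) (deriv qd t)

/-- Desired position and attitude of the rod, with the bounds on the derivatives that make the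
desired accelerations, and the rate of change of the desired cable forces, bounded. -/
structure Reference where
  xd : ℝ → E3
  qd : ℝ → E3
  xd_smooth : ContDiff ℝ 4 xd
  qd_smooth : ContDiff ℝ 4 qd
  qd_unit : ∀ t, ‖qd t‖ = 1
  bounded : ∃ B : ℝ, ∀ t, 0 ≤ t →
    ‖deriv (velDes xd) t‖ ≤ B ∧ ‖deriv (deriv (velDes xd)) t‖ ≤ B ∧
    ‖angVel qd t‖ ≤ B ∧ ‖deriv (angVel qd) t‖ ≤ B ∧ ‖deriv (deriv (angVel qd)) t‖ ≤ B

/-- A curve of states: position and velocity of the rod, attitude and angular velocity of the rod,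
attitudes and angular velocities of the cables. -/
structure Motion where
  x : ℝ → E3
  v : ℝ → E3
  qr : ℝ → E3
  ωr : ℝ → E3
  q : Fin 2 → ℝ → E3
  ω : Fin 2 → ℝ → E3

/-- Disturbances acting on the rod position, rod attitude and cable attitude dynamics. -/
structure Disturbance where
  x : ℝ → E3
  qr : ℝ → E3
  q : Fin 2 → ℝ → E3

/-- Bounds for the disturbances. -/
structure DistBound where
  x : ℝ
  qr : ℝ
  q : Fin 2 → ℝ

/-- The disturbance obeys the bounds on the time set `J`. -/
def Disturbance.BoundedBy (d : Disturbance) (δ : DistBound) (J : Set ℝ) : Prop :=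
  ∀ t ∈ J, ‖d.x t‖ ≤ δ.x ∧ ‖d.qr t‖ ≤ δ.qr ∧ ∀ j, ‖d.q j t‖ ≤ δ.q j

section ControlLaw

variable (p : Params) (K : RodGains) (C : CableGains) (r : Reference) (s : Motion)

/-! ### Rod errors and desired cable forces -/

/-- Position error of the rod. -/
def ex (t : ℝ) : E3 := s.x t - r.xd t

/-- Velocity error of the rod. -/
def ev (t : ℝ) : E3 := s.v t - velDes r.xd t

/-- Attitude error of the rod. -/
def eqr (t : ℝ) : E3 := cross (r.qd t) (s.qr t)

/-- Angular velocity error of the rod. -/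
def eωr (t : ℝ) : E3 := s.ωr t + cross (s.qr t) (cross (s.qr t) (angVel r.qd t))

/-- Configuration error of the rod attitude. -/
def Ψr (t : ℝ) : ℝ := 1 - ⟪r.qd t, s.qr t⟫_ℝ

/-- The sum of the two desired cable forces. -/
def muSum (t : ℝ) : E3 :=
  p.mr • (deriv (velDes r.xd) t + p.g • e3 - K.kv • ev r s t - K.kx • ex r s t)

/-- The difference (second minus first) of the two desired cable forces. -/
def muDiff (t : ℝ) : E3 :=
  (2 / 3 * p.mr * p.Lr) •
    (-cross (s.qr t) (deriv (angVel r.qd) t)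
      + (⟪s.qr t, angVel r.qd t⟫_ℝ) • cross (s.qr t) (cross (s.qr t) (angVel r.qd t))
      - (⟪s.qr t, angVel r.qd t⟫_ℝ) • eωr r s t
      + K.kω • cross (s.qr t) (eωr r s t)
      + K.kq • cross (s.qr t) (eqr r s t))

/-- The desired cable forces. -/
def muDes (j : Fin 2) (t : ℝ) : E3 :=
  (1 / 2 : ℝ) • (muSum p K r s t + sgn j • muDiff p K r s t)

/-- The applied cable forces: the desired ones, projected onto the cables. -/
def mu (j : Fin 2) (t : ℝ) : E3 :=
  muDes p K r s j t + cross (s.q j t) (cross (s.q j t) (muDes p K r s j t))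

/-! ### Desired cable attitudes and cable errors along a motion on the time interval `J` -/

/-- The desired cable attitudes. -/
def qDes (j : Fin 2) (t : ℝ) : E3 := -(‖muDes p K r s j t‖⁻¹ • muDes p K r s j t)

/-- The angular velocities of the desired cable attitudes. -/
def ωDes (J : Set ℝ) (j : Fin 2) (t : ℝ) : E3 :=
  cross (qDes p K r s j t) (derivWithin (qDes p K r s j) J t)

/-- Attitude errors of the cables. -/
def eqc (j : Fin 2) (t : ℝ) : E3 := cross (qDes p K r s j t) (s.q j t)

/-- Angular velocity errors of the cables. -/
def eωc (J : Set ℝ) (j : Fin 2) (t : ℝ) : E3 :=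
  s.ω j t + cross (s.q j t) (cross (s.q j t) (ωDes p K r s J j t))

/-- Configuration errors of the cable attitudes. -/
def Ψ (j : Fin 2) (t : ℝ) : ℝ := 1 - ⟪qDes p K r s j t, s.q j t⟫_ℝ

/-! ### The thrusts -/

/-- Acceleration of the rod. -/
def accX (J : Set ℝ) (t : ℝ) : E3 := derivWithin s.v J t

/-- Second derivative of the rod attitude. -/
def accQr (J : Set ℝ) (t : ℝ) : E3 := derivWithin (derivWithin s.qr J) J t

/-- The component of the thrust parallel to the cable. -/
def uPar (J : Set ℝ) (j : Fin 2) (t : ℝ) : E3 :=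
  mu p K r s j t + p.mQ •
    (par (s.q j t) (accX s J t) + p.g • par (s.q j t) e3
      + (p.Lc * ‖s.ω j t‖ ^ 2) • s.q j t + (sgn j * p.Lr) • par (s.q j t) (accQr s J t))

/-- The component of the thrust perpendicular to the cable. -/
def uPerp (J : Set ℝ) (j : Fin 2) (t : ℝ) : E3 :=
  -(p.mQ • cross (s.q j t) (cross (s.q j t)
      (accX s J t + (sgn j * p.Lr) • accQr s J t + p.g • e3
        + p.Lc • cross (s.q j t) (derivWithin (ωDes p K r s J j) J t)
        - (p.Lc * ⟪s.q j t, ωDes p K r s J j t⟫_ℝ) • s.ω j t)))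
  - (p.mQ * p.Lc) • cross (s.q j t)
      (C.kq j • eqc p K r s j t + C.kω j • eωc p K r s J j t)

/-- The thrust of quadrotor `j`. -/
def thrust (J : Set ℝ) (j : Fin 2) (t : ℝ) : E3 :=
  uPar p K r s J j t + uPerp p K C r s J j t

/-- `s` is a solution on the time interval `J` of the reduced dynamics with disturbance `d`, in
closed loop with the control law. The desired cable forces do not vanish and the desired angular
velocities of the cables are differentiable, as the control law requires. -/
structure IsSolution (d : Disturbance) (J : Set ℝ) : Prop where
  qr_unit : ∀ t ∈ J, ‖s.qr t‖ = 1
  ωr_tangent : ∀ t ∈ J, ⟪s.ωr t, s.qr t⟫_ℝ = 0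
  q_unit : ∀ j, ∀ t ∈ J, ‖s.q j t‖ = 1
  ω_tangent : ∀ j, ∀ t ∈ J, ⟪s.ω j t, s.q j t⟫_ℝ = 0
  x_kin : ∀ t ∈ J, HasDerivWithinAt s.x (s.v t) J t
  v_diff : DifferentiableOn ℝ s.v J
  v_dyn : ∀ t ∈ J, p.mr • (derivWithin s.v J t + p.g • e3)
    = mu p K r s 0 t + mu p K r s 1 t + d.x t
  qr_kin : ∀ t ∈ J, HasDerivWithinAt s.qr (cross (s.ωr t) (s.qr t)) J t
  ωr_diff : DifferentiableOn ℝ s.ωr J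
  ωr_dyn : ∀ t ∈ J, (2 / 3 * p.mr * p.Lr) • derivWithin s.ωr J t
    = cross (s.qr t) (mu p K r s 1 t - mu p K r s 0 t) + d.qr t
  q_kin : ∀ j, ∀ t ∈ J, HasDerivWithinAt (s.q j) (cross (s.ω j t) (s.q j t)) J t
  ω_diff : ∀ j, DifferentiableOn ℝ (s.ω j) J
  ω_dyn : ∀ j, ∀ t ∈ J, (p.mQ * p.Lc) • derivWithin (s.ω j) J t
    = p.mQ • cross (s.q j t) (accX s J t + (sgn j * p.Lr) • accQr s J t + p.g • e3)
      - cross (s.q j t) (thrust p K C r s J j t) + d.q j t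
  muDes_ne : ∀ j, ∀ t ∈ J, muDes p K r s j t ≠ 0
  ωDes_diff : ∀ j, DifferentiableOn ℝ (ωDes p K r s J j) J

/-- The Euclidean norm of the vector of all tracking errors. -/
def errNorm (J : Set ℝ) (t : ℝ) : ℝ :=
  Real.sqrt (‖ex r s t‖ ^ 2 + ‖ev r s t‖ ^ 2 + ‖eqr r s t‖ ^ 2 + ‖eωr r s t‖ ^ 2
    + ∑ j, (‖eqc p K r s j t‖ ^ 2 + ‖eωc p K r s J j t‖ ^ 2))

/-- The bounds that define the domain of admissible errors, apart from the bounds on the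
configuration errors of the cables. -/
structure DomainBound where
  ex : ℝ
  ev : ℝ
  eωr : ℝ
  eω : Fin 2 → ℝ
  ψr : ℝ
  ex_pos : 0 < ex
  ev_pos : 0 < ev
  eωr_pos : 0 < eωr
  eω_pos : ∀ j, 0 < eω j
  ψr_pos : 0 < ψr
  ψr_lt : ψr < 1

/-- At time `t` the tracking errors lie in the domain given by the bounds `D` and `ψ`. -/
def InDomain (D : DomainBound) (ψ : Fin 2 → ℝ) (J : Set ℝ) (t : ℝ) : Prop :=
  ‖ex r s t‖ ≤ D.ex ∧ ‖ev r s t‖ ≤ D.ev ∧ ‖eωr r s t‖ ≤ D.eωr ∧ Ψr r s t ≤ D.ψr ∧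
  ∀ j, ‖eωc p K r s J j t‖ ≤ D.eω j ∧ Ψ p K r s j t ≤ ψ j

end ControlLaw

/-- The size `α` of the cable attitude errors that the bounds `ψ` on the configuration errors
allow. -/
def cableSize (ψ : Fin 2 → ℝ) : ℝ :=
  2 * max (Real.sqrt (ψ 0 * (2 - ψ 0))) (Real.sqrt (ψ 1 * (2 - ψ 1)))

/-- The tracking errors of the disturbed closed loop are uniformly ultimately bounded with ultimate
bound `b`, for initial errors in the domain given by `D` and `ψ`: after a time `T` that depends
neither on the initial time, nor on the initial state, nor on the disturbance, the error norm is at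
most `b`. Solutions are considered on `[t₀, t₁]` for every `t₁`, so this includes the solutions on
`[t₀, ∞)`. Only those solutions are considered along which the desired cable forces, whose
directions are the desired cable attitudes, have norm at least `m₀`. -/
def UniformlyUltimatelyBounded (p : Params) (K : RodGains) (C : CableGains) (r : Reference)
    (δ : DistBound) (D : DomainBound) (ψ : Fin 2 → ℝ) (m₀ b : ℝ) : Prop :=
  ∃ T : ℝ, 0 ≤ T ∧ ∀ (t₀ t₁ : ℝ) (s : Motion) (d : Disturbance), 0 ≤ t₀ →
    IsSolution p K C r s d (Set.Icc t₀ t₁) →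
    d.BoundedBy δ (Set.Icc t₀ t₁) →
    (∀ j, ∀ t ∈ Set.Icc t₀ t₁, m₀ ≤ ‖muDes p K r s j t‖) →
    InDomain p K r s D ψ (Set.Icc t₀ t₁) t₀ →
    ∀ t ∈ Set.Icc (t₀ + T) t₁, errNorm p K r s (Set.Icc t₀ t₁) t ≤ b

end RodTransport

end

noncomputable section

namespace RodTransport

open scoped InnerProductSpace

/-! ### The cross product -/

/-! One scalar estimate serves all loops. With gains `k ^ 2` and `2 * k`, the position loop and the
three attitude loops are second order systems with a potential `Ψ`, and the energy `k ^ 2 * Ψ + Y ^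
2 / 2 + (k / 2) * c`, where `c` pairs the configuration error with the velocity error, decays at a
rate proportional to `k` down to a level of order `D ^ 2 / k ^ 2`, with `D` a bound for the
disturbance (`SecondOrder.energy_le`). On the sphere this requires `Ψ` to stay away from its
antipodal value 2. For a start with `Ψ ≤ ψ < 1` and large `k` the energy itself ensures this
(`SecondOrder.le_envelope_of_sphere`).

The cables disturb the rod only through the force error, which is at most `‖muDes‖ * ‖eqc‖`
(`norm_muErr_le`). The rod gains are fixed first, with the force errors treated as disturbances of
norm at most 1 (`exists_rodGain`). While the rod errors stay in a large ball, the desired forces and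
the rates of the rod errors and of the desired forces have a bound `M` free of the cable gains,
because the rod is driven by the projected forces and not by the thrusts (`exists_C1Bound`).
Together with `‖muDes‖ ≥ m₀`, this bounds the reference angular velocities of the cables; `m₀` plays
no other role, so the rod gains can precede it. The number `M` determines a time `τ` during which
the rod errors drift only within a fixed margin, and the cable gains are taken so large that the
force errors are at most 1 from time `τ` on (`exists_cableGain`).

The ball assumption is removed by a continuity argument (`lt_of_continuousOn_of_bootstrap`): the
drift bound up to time `τ` and the decay of the rod errors afterwards both end strictly inside the
ball. -/

theorem inner_eq_coords (a b : E3) : ⟪a, b⟫_ℝ = a 0 * b 0 + a 1 * b 1 + a 2 * b 2 := by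
  simp [PiLp.inner_apply, Fin.sum_univ_three, mul_comm]

theorem cross_coords (a b : E3) :
    cross a b 0 = a 1 * b 2 - a 2 * b 1 ∧ cross a b 1 = a 2 * b 0 - a 0 * b 2 ∧
      cross a b 2 = a 0 * b 1 - a 1 * b 0 := by
  simp [cross, cross_apply]

/-- The cross product as a bilinear map. -/
def crossLin : E3 →ₗ[ℝ] E3 →ₗ[ℝ] E3 :=
  LinearMap.mk₂ ℝ cross
    (by intro a b c; ext i; fin_cases i <;> simp [cross_coords] <;> ring)
    (by intro a b c; ext i; fin_cases i <;> simp [cross_coords] <;> ring)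
    (by intro a b c; ext i; fin_cases i <;> simp [cross_coords] <;> ring)
    (by intro a b c; ext i; fin_cases i <;> simp [cross_coords] <;> ring)

theorem norm_cross_sq (a b : E3) : ‖cross a b‖ ^ 2 = ‖a‖ ^ 2 * ‖b‖ ^ 2 - ⟪a, b⟫_ℝ ^ 2 := by
  simp only [← real_inner_self_eq_norm_sq, inner_eq_coords, cross_coords]
  ring

theorem norm_cross_le (a b : E3) : ‖cross a b‖ ≤ ‖a‖ * ‖b‖ := by
  refine (sq_le_sq₀ (norm_nonneg _) (by positivity)).1 ?_
  rw [norm_cross_sq]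
  nlinarith [sq_nonneg ⟪a, b⟫_ℝ]

/-- The cross product as a continuous bilinear map. -/
def crossCLM : E3 →L[ℝ] E3 →L[ℝ] E3 :=
  crossLin.mkContinuous₂ 1 (by intro a b; simpa [crossLin] using norm_cross_le a b)

@[simp] theorem crossCLM_apply (a b : E3) : crossCLM a b = cross a b := rfl

theorem hasDerivWithinAt_cross {f g : ℝ → E3} {f' g' : E3} {J : Set ℝ} {t : ℝ}
    (hf : HasDerivWithinAt f f' J t) (hg : HasDerivWithinAt g g' J t) :
    HasDerivWithinAt (fun t => cross (f t) (g t)) (cross f' (g t) + cross (f t) g') J t := by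
  have := crossCLM.hasDerivWithinAt_of_bilinear hf hg
  simpa [add_comm] using this

theorem cross_add_right (a b c : E3) : cross a (b + c) = cross a b + cross a c :=
  (crossLin a).map_add b c

theorem cross_sub_right (a b c : E3) : cross a (b - c) = cross a b - cross a c :=
  (crossLin a).map_sub b c

theorem cross_smul_right (x : ℝ) (a b : E3) : cross a (x • b) = x • cross a b :=
  (crossLin a).map_smul x b

theorem cross_neg_right (a b : E3) : cross a (-b) = -cross a b :=
  (crossLin a).map_neg b

theorem cross_self' (a : E3) : cross a a = 0 := by
  ext i; fin_cases i <;> simp [cross_coords] <;> ring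

theorem cross_anticomm' (a b : E3) : cross a b = -cross b a := by
  ext i; fin_cases i <;> simp [cross_coords] <;> ring

theorem cross_cross_right (a b c : E3) :
    cross a (cross b c) = ⟪a, c⟫_ℝ • b - ⟪a, b⟫_ℝ • c := by
  ext i; fin_cases i <;> simp [cross_coords, inner_eq_coords] <;> ring

theorem cross_cross_left (a b c : E3) :
    cross (cross a b) c = ⟪a, c⟫_ℝ • b - ⟪b, c⟫_ℝ • a := by
  ext i; fin_cases i <;> simp [cross_coords, inner_eq_coords] <;> ring

theorem inner_cross_left_self (a b : E3) : ⟪cross a b, a⟫_ℝ = 0 := by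
  simp [cross_coords, inner_eq_coords]; ring

theorem inner_cross_right_self (a b : E3) : ⟪cross a b, b⟫_ℝ = 0 := by
  simp [cross_coords, inner_eq_coords]; ring

/-- The square of the hat map of a unit vector is minus the orthogonal projection onto the tangent
plane. All simplifications of the control law rest on this. -/
theorem cross_cross_self_of_unit {q : E3} (hq : ‖q‖ = 1) (w : E3) :
    cross q (cross q w) = ⟪q, w⟫_ℝ • q - w := by
  rw [cross_cross_right, real_inner_self_eq_norm_sq, hq]; simp

/-- A curve on the unit sphere is transported by its angular velocity. -/
theorem cross_angular_velocity {q q' : E3} (hq : ‖q‖ = 1) (h : ⟪q, q'⟫_ℝ = 0) :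
    cross (cross q q') q = q' := by
  rw [cross_cross_left, real_inner_self_eq_norm_sq, hq, real_inner_comm, h]; simp

/-- The velocity of a curve on the unit sphere is tangent to the sphere. -/
theorem inner_deriv_eq_zero_of_unit {q : ℝ → E3} {q' : E3} {J : Set ℝ} {t : ℝ} (ht : t ∈ J)
    (hJ : UniqueDiffWithinAt ℝ J t) (hq : ∀ s ∈ J, ‖q s‖ = 1)
    (h : HasDerivWithinAt q q' J t) : ⟪q t, q'⟫_ℝ = 0 := by
  have h1 := h.inner ℝ h
  have h2 : HasDerivWithinAt (fun s => ⟪q s, q s⟫_ℝ) 0 J t := by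
    refine (hasDerivWithinAt_const t J (1 : ℝ)).congr (fun s hs => ?_) ?_
    · rw [real_inner_self_eq_norm_sq, hq s hs]; norm_num
    · rw [real_inner_self_eq_norm_sq, hq t ht]; norm_num
  have h3 := hJ.eq_deriv J h1 h2
  rw [real_inner_comm q' (q t)] at h3
  have := real_inner_comm q' (q t)
  linarith

/-! ### A scalar Lyapunov estimate -/

/-- Linear differential inequality. -/
theorem le_exp_of_deriv_le {a b lam C : ℝ} {W W' : ℝ → ℝ}
    (hW : ∀ t ∈ Set.Icc a b, HasDerivWithinAt W (W' t) (Set.Icc a b) t)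
    (h : ∀ t ∈ Set.Icc a b, W' t ≤ -lam * (W t - C)) :
    ∀ t ∈ Set.Icc a b, W t - C ≤ (W a - C) * Real.exp (-(lam * (t - a))) := by
  intro t ht
  have hG : ∀ s ∈ Set.Icc a b, HasDerivWithinAt (fun s => (W s - C) * Real.exp (lam * (s - a)))
      (W' s * Real.exp (lam * (s - a)) + (W s - C) * (Real.exp (lam * (s - a)) * lam))
      (Set.Icc a b) s := by
    intro s hs
    have h1 : HasDerivWithinAt (fun s => lam * (s - a)) lam (Set.Icc a b) s := by
      simpa using (((hasDerivWithinAt_id s (Set.Icc a b)).sub_const a).const_mul lam)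
    exact ((hW s hs).sub_const C).mul h1.exp
  have hanti : AntitoneOn (fun s => (W s - C) * Real.exp (lam * (s - a))) (Set.Icc a b) := by
    apply antitoneOn_of_hasDerivWithinAt_nonpos (convex_Icc a b)
      (fun s hs => (hG s hs).continuousWithinAt)
      (fun s hs => (hG s (interior_subset hs)).mono interior_subset)
    intro s hs
    have := h s (interior_subset hs)
    nlinarith [Real.exp_pos (lam * (s - a))]
  have h2 := hanti (Set.left_mem_Icc.2 (ht.1.trans ht.2)) ht ht.1
  simp only [sub_self, mul_zero, Real.exp_zero, mul_one] at h2
  rw [Real.exp_neg, ← div_eq_mul_inv, le_div_iff₀ (Real.exp_pos _)]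
  exact h2

/-- Continuous induction: a strict bound that can be improved from a weak one persists. -/
theorem lt_of_continuousOn_of_bootstrap {a b M : ℝ} {f : ℝ → ℝ}
    (hf : ContinuousOn f (Set.Icc a b)) (ha : f a < M)
    (h : ∀ t ∈ Set.Icc a b, (∀ s ∈ Set.Icc a t, f s ≤ M) → f t < M) :
    ∀ t ∈ Set.Icc a b, f t < M := by
  intro t ht
  by_contra hcon
  push Not at hcon
  set S := {s ∈ Set.Icc a b | M ≤ f s} with hS
  have hSc : IsCompact S := by
    have : IsClosed S := hf.preimage_isClosed_of_isClosed isClosed_Icc isClosed_Ici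
    exact isCompact_Icc.of_isClosed_subset this (fun s hs => hs.1)
  -- The first time at which the strict bound fails.
  obtain ⟨s, hs⟩ := hSc.exists_isLeast ⟨t, ht, hcon⟩
  have hsI := hs.1.1
  refine absurd hs.1.2 (not_le.2 (h s hsI (fun u hu => ?_)))
  rcases eq_or_lt_of_le hu.2 with rfl | hlt
  -- At the first time itself a value above `M` is impossible: the intermediate value theorem would
  -- give a time in `S` at which the value is exactly `M`, and this time cannot be earlier.
  · by_contra hgt
    push Not at hgt
    have hcont : ContinuousOn f (Set.Icc a u) := hf.mono (Set.Icc_subset_Icc_right hsI.2)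
    obtain ⟨v, hv, hfv⟩ := intermediate_value_Icc hsI.1 hcont ⟨ha.le, hgt.le⟩
    have hvu := hs.2 ⟨⟨hv.1, hv.2.trans hsI.2⟩, hfv.ge⟩
    have : v = u := le_antisymm hv.2 hvu
    rw [this] at hfv
    exact hgt.ne' hfv
  · by_contra hgt
    push Not at hgt
    exact absurd (hs.2 ⟨⟨hu.1, hu.2.trans hsI.2⟩, hgt.le⟩) (not_le.2 hlt)

/-- Scalar data of a second order error system with gains `k ^ 2` and `2 * k`: `Ψ` is the
potential, `X` and `Y` are the norms of the configuration and velocity errors, and `c` is their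
inner product. -/
structure SecondOrder (k B D a b : ℝ) (Ψ X Y c w' c' : ℝ → ℝ) : Prop where
  X_nonneg : ∀ t ∈ Set.Icc a b, 0 ≤ X t
  Y_nonneg : ∀ t ∈ Set.Icc a b, 0 ≤ Y t
  X_sq_le : ∀ t ∈ Set.Icc a b, X t ^ 2 ≤ 2 * Ψ t
  c_abs : ∀ t ∈ Set.Icc a b, |c t| ≤ X t * Y t
  Ψ_deriv : ∀ t ∈ Set.Icc a b, HasDerivWithinAt Ψ (c t) (Set.Icc a b) t
  Y_deriv : ∀ t ∈ Set.Icc a b, HasDerivWithinAt (fun t => Y t ^ 2) (w' t) (Set.Icc a b) t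
  c_deriv : ∀ t ∈ Set.Icc a b, HasDerivWithinAt c (c' t) (Set.Icc a b) t
  w'_le : ∀ t ∈ Set.Icc a b, w' t ≤ 2 * (-k ^ 2 * c t - 2 * k * Y t ^ 2 + D * Y t)
  c'_le : ∀ t ∈ Set.Icc a b,
    c' t ≤ -k ^ 2 * X t ^ 2 - 2 * k * c t + D * X t + Y t ^ 2 + B * (X t * Y t)

theorem SecondOrder.mono {k B D a b b' : ℝ} {Ψ X Y c w' c' : ℝ → ℝ}
    (h : SecondOrder k B D a b Ψ X Y c w' c') (hb : b' ≤ b) :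
    SecondOrder k B D a b' Ψ X Y c w' c' := by
  have hs : Set.Icc a b' ⊆ Set.Icc a b := Set.Icc_subset_Icc_right hb
  exact ⟨fun t ht => h.1 t (hs ht), fun t ht => h.2 t (hs ht), fun t ht => h.3 t (hs ht),
    fun t ht => h.4 t (hs ht), fun t ht => (h.5 t (hs ht)).mono hs,
    fun t ht => (h.6 t (hs ht)).mono hs, fun t ht => (h.7 t (hs ht)).mono hs,
    fun t ht => h.8 t (hs ht), fun t ht => h.9 t (hs ht)⟩

/-- In the variables `x = k * X` and `Y` the choice of gains makes every undisturbed term scale with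
`k`. The potential force cancels in the energy balance, and the cross term with weight `k / 2`
supplies the missing damping of `x`. What remains is `k` times a negative definite form. It absorbs
the term with `B`, as `4 * B ≤ k`, and the terms with `D` by Young's inequality. The factor `μ` is
the price for controlling `Ψ` by `X ^ 2`. -/
theorem lyapunov_rate {k B D μ Ψ X Y c : ℝ} (hk : 0 < k) (hkB : 4 * B ≤ k) (hB : 0 ≤ B)
    (hμ : 0 < μ) (hμ1 : μ ≤ 1) (hX : 0 ≤ X) (hY : 0 ≤ Y)
    (hΨ : μ * Ψ ≤ X ^ 2) (hc : |c| ≤ X * Y) :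
    k ^ 2 * c + (-k ^ 2 * c - 2 * k * Y ^ 2 + D * Y)
      + k / 2 * (-k ^ 2 * X ^ 2 - 2 * k * c + D * X + Y ^ 2 + B * (X * Y))
    ≤ -(k * μ / 16) * (k ^ 2 * Ψ + 1 / 2 * Y ^ 2 + k / 2 * c - 128 * D ^ 2 / (μ * k ^ 2)) := by
  obtain ⟨hc1, hc2⟩ := abs_le.1 hc
  obtain ⟨x, hx⟩ : ∃ x, x = k * X := ⟨_, rfl⟩
  have hx0 : 0 ≤ x := by rw [hx]; positivity
  -- The constant 128 is 16 times 8: the two Young inequalities below cost `4 * D ^ 2 / k` each.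
  have h1 : -(k * μ / 16) * (-(128 * D ^ 2 / (μ * k ^ 2))) = 8 * D ^ 2 / k := by
    field_simp; ring
  have h2 : μ * (k ^ 2 * Ψ + 1 / 2 * Y ^ 2 + k / 2 * c) ≤ 2 * (x ^ 2 + Y ^ 2) := by
    have e1 : μ * (k ^ 2 * Ψ) ≤ x ^ 2 := by
      rw [hx]; nlinarith [mul_le_mul_of_nonneg_left hΨ (sq_nonneg k)]
    have e2 : μ * (1 / 2 * Y ^ 2) ≤ 1 / 2 * Y ^ 2 :=
      mul_le_of_le_one_left (by positivity) hμ1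
    have e3 : μ * (k / 2 * c) ≤ 1 / 2 * (x * Y) := by
      have : k / 2 * c ≤ 1 / 2 * (x * Y) := by
        rw [hx]; nlinarith
      have h0 : 0 ≤ 1 / 2 * (x * Y) := by positivity
      calc μ * (k / 2 * c) ≤ μ * (1 / 2 * (x * Y)) := by gcongr
        _ ≤ _ := mul_le_of_le_one_left h0 hμ1
    nlinarith [sq_nonneg (x - Y)]
  have h3 : D * x ≤ k / 16 * x ^ 2 + 4 * D ^ 2 / k := by
    have : k / 16 * x ^ 2 + 4 * D ^ 2 / k - D * x = k / 16 * (x - 8 * D / k) ^ 2 := by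
      field_simp; ring
    have h0 : 0 ≤ k / 16 * (x - 8 * D / k) ^ 2 := by positivity
    linarith
  have h4 : D * Y ≤ k / 16 * Y ^ 2 + 4 * D ^ 2 / k := by
    have : k / 16 * Y ^ 2 + 4 * D ^ 2 / k - D * Y = k / 16 * (Y - 8 * D / k) ^ 2 := by
      field_simp; ring
    have h0 : 0 ≤ k / 16 * (Y - 8 * D / k) ^ 2 := by positivity
    linarith
  have h5 : -(k ^ 2 * c) ≤ k * (x * Y) := by
    rw [hx]; nlinarith [mul_le_mul_of_nonneg_left hc1 (sq_nonneg k)]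
  have h6 : B / 2 * (x * Y) ≤ k / 16 * (x ^ 2 + Y ^ 2) := by
    have : 0 ≤ x * Y := by positivity
    nlinarith [sq_nonneg (x - Y), sq_nonneg x, sq_nonneg Y]
  have h7 : k * (-(1 / 2) * x ^ 2 + x * Y - 3 / 2 * Y ^ 2)
      ≤ k * (-(1 / 4) * x ^ 2 - 1 / 2 * Y ^ 2) := by
    gcongr k * ?_; nlinarith [sq_nonneg (x / 2 - Y)]
  have h8 : k / 16 * (μ * (k ^ 2 * Ψ + 1 / 2 * Y ^ 2 + k / 2 * c))
      ≤ k / 16 * (2 * (x ^ 2 + Y ^ 2)) := by gcongr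
  have h9 : 8 * D ^ 2 / k = 2 * (4 * D ^ 2 / k) := by ring
  have h10 : 0 ≤ D ^ 2 / k := by positivity
  have lhs : k ^ 2 * c + (-k ^ 2 * c - 2 * k * Y ^ 2 + D * Y)
      + k / 2 * (-k ^ 2 * X ^ 2 - 2 * k * c + D * X + Y ^ 2 + B * (X * Y))
      = -(k ^ 2 * c) + k * (-(1 / 2) * x ^ 2 - 3 / 2 * Y ^ 2) + D * Y + 1 / 2 * (D * x)
        + B / 2 * (x * Y) := by rw [hx]; ring
  rw [lhs]
  have rhs : -(k * μ / 16) * (k ^ 2 * Ψ + 1 / 2 * Y ^ 2 + k / 2 * c - 128 * D ^ 2 / (μ * k ^ 2))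
      = -(k / 16 * (μ * (k ^ 2 * Ψ + 1 / 2 * Y ^ 2 + k / 2 * c))) + 8 * D ^ 2 / k := by
    rw [← h1]; ring
  rw [rhs]
  have h11 : 1 / 2 * (D * x) ≤ k / 16 * x ^ 2 + 4 * D ^ 2 / k := by
    have : 0 ≤ k / 16 * x ^ 2 + 4 * D ^ 2 / k := by positivity
    linarith
  nlinarith [mul_nonneg hk.le (sq_nonneg x), mul_nonneg hk.le (sq_nonneg Y)]

/-- Exponential decay of a second order error system up to a disturbance term. -/
theorem SecondOrder.energy_le {k B D μ a b : ℝ} {Ψ X Y c w' c' : ℝ → ℝ}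
    (h : SecondOrder k B D a b Ψ X Y c w' c') (hk : 0 < k) (hkB : 4 * B ≤ k) (hB : 0 ≤ B)
    (hμ : 0 < μ) (hμ1 : μ ≤ 1) (hΨ : ∀ t ∈ Set.Icc a b, μ * Ψ t ≤ X t ^ 2) :
    ∀ t ∈ Set.Icc a b, 1 / 2 * (k ^ 2 * Ψ t) + 1 / 4 * Y t ^ 2 ≤
      (k ^ 2 * Ψ a + 1 / 2 * Y a ^ 2 + k / 2 * (X a * Y a)) * Real.exp (-(k * μ / 16 * (t - a)))
        + 128 * D ^ 2 / (μ * k ^ 2) := by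
  intro t ht
  have hW : ∀ t ∈ Set.Icc a b,
      HasDerivWithinAt (fun t => k ^ 2 * Ψ t + 1 / 2 * Y t ^ 2 + k / 2 * c t)
        (k ^ 2 * c t + 1 / 2 * w' t + k / 2 * c' t) (Set.Icc a b) t := fun t ht =>
    (((h.Ψ_deriv t ht).const_mul _).add ((h.Y_deriv t ht).const_mul _)).add
      ((h.c_deriv t ht).const_mul _)
  have key := le_exp_of_deriv_le (lam := k * μ / 16) (C := 128 * D ^ 2 / (μ * k ^ 2)) hW (by
    intro t ht
    refine le_trans ?_ (lyapunov_rate hk hkB hB hμ hμ1 (h.X_nonneg t ht) (h.Y_nonneg t ht)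
      (hΨ t ht) (h.c_abs t ht))
    have e1 := h.w'_le t ht
    have e2 := mul_le_mul_of_nonneg_left (h.c'_le t ht) (by positivity : 0 ≤ k / 2)
    linarith) t ht
  have ha : a ∈ Set.Icc a b := ⟨le_rfl, ht.1.trans ht.2⟩
  have hexp := Real.exp_pos (-(k * μ / 16 * (t - a)))
  have hca : k / 2 * c a ≤ k / 2 * (X a * Y a) := by
    have := (abs_le.1 (h.c_abs a ha)).2
    gcongr
  have hct : -(k / 2 * (X t * Y t)) ≤ k / 2 * c t := by
    have := (abs_le.1 (h.c_abs t ht)).1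
    nlinarith
  have hXt := mul_le_mul_of_nonneg_left (h.X_sq_le t ht) (sq_nonneg k)
  have hC : 0 ≤ 128 * D ^ 2 / (μ * k ^ 2) := by positivity
  -- Since `X ^ 2 ≤ 2 * Ψ`, the cross term takes away at most half of the energy.
  have hlow : 1 / 2 * (k ^ 2 * Ψ t) + 1 / 4 * Y t ^ 2
      ≤ k ^ 2 * Ψ t + 1 / 2 * Y t ^ 2 + k / 2 * c t := by
    nlinarith [sq_nonneg (k * X t - Y t)]
  have hup : (k ^ 2 * Ψ a + 1 / 2 * Y a ^ 2 + k / 2 * c a - 128 * D ^ 2 / (μ * k ^ 2))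
      * Real.exp (-(k * μ / 16 * (t - a)))
      ≤ (k ^ 2 * Ψ a + 1 / 2 * Y a ^ 2 + k / 2 * (X a * Y a))
        * Real.exp (-(k * μ / 16 * (t - a))) := by
    gcongr
    linarith
  linarith

/-- The envelope of the errors at time `s` after the start. -/
def envelope (κ k s : ℝ) : ℝ := κ * k ^ 2 * Real.exp (-(k * s / κ)) + κ / k ^ 2

/-- Second order systems with a quadratic potential. -/
theorem SecondOrder.le_envelope_of_quadratic {k B D a b X₀ Y₀ κ : ℝ} {Ψ X Y c w' c' : ℝ → ℝ}
    (h : SecondOrder k B D a b Ψ X Y c w' c') (hk1 : 1 ≤ k) (hkB : 4 * B ≤ k) (hB : 0 ≤ B)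
    (hκ : 4 * (X₀ ^ 2 + Y₀ ^ 2) + 16 + 512 * D ^ 2 ≤ κ)
    (hX : X a ≤ X₀) (hY : Y a ≤ Y₀) (hΨ : ∀ t ∈ Set.Icc a b, 2 * Ψ t = X t ^ 2) :
    ∀ t ∈ Set.Icc a b, k ^ 2 * X t ^ 2 + Y t ^ 2 ≤ envelope κ k (t - a) := by
  intro t ht
  have hk : 0 < k := by linarith
  have ha : a ∈ Set.Icc a b := ⟨le_rfl, ht.1.trans ht.2⟩
  have hXa := h.X_nonneg a ha
  have hYa := h.Y_nonneg a ha
  have hen := h.energy_le hk hkB hB one_pos le_rfl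
    (fun t ht => by nlinarith [hΨ t ht, sq_nonneg (X t)]) t ht
  have hX2 : X a ^ 2 ≤ X₀ ^ 2 := by gcongr
  have hY2 : Y a ^ 2 ≤ Y₀ ^ 2 := by gcongr
  have h0 : k ^ 2 * Ψ a + 1 / 2 * Y a ^ 2 + k / 2 * (X a * Y a) ≤ κ / 4 * k ^ 2 := by
    have e1 := hΨ a ha
    have e2 : Y a ^ 2 ≤ k ^ 2 * Y a ^ 2 := le_mul_of_one_le_left (sq_nonneg _) (by nlinarith)
    have e3 : k ^ 2 * (X a ^ 2 + Y a ^ 2) ≤ k ^ 2 * (κ / 4) := by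
      gcongr; nlinarith [sq_nonneg D]
    nlinarith [sq_nonneg (k * X a - Y a)]
  have hκ16 : 16 ≤ κ := by nlinarith [sq_nonneg D, sq_nonneg X₀, sq_nonneg Y₀]
  have hexp : Real.exp (-(k * 1 / 16 * (t - a))) ≤ Real.exp (-(k * (t - a) / κ)) := by
    apply Real.exp_le_exp.2
    have : k * (t - a) / κ ≤ k * (t - a) / 16 := by
      have := ht.1
      have : 0 ≤ k * (t - a) := mul_nonneg hk.le (by linarith)
      gcongr
    linarith
  have h1 : (k ^ 2 * Ψ a + 1 / 2 * Y a ^ 2 + k / 2 * (X a * Y a))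
      * Real.exp (-(k * 1 / 16 * (t - a))) ≤ κ / 4 * k ^ 2 * Real.exp (-(k * (t - a) / κ)) := by
    gcongr
  have h2 : 4 * (128 * D ^ 2 / (1 * k ^ 2)) ≤ κ / k ^ 2 := by
    rw [one_mul, ← mul_div_assoc]
    gcongr
    nlinarith [sq_nonneg X₀, sq_nonneg Y₀]
  have h3 := hΨ t ht
  have h4 : k ^ 2 * X t ^ 2 = 2 * (k ^ 2 * Ψ t) := by rw [← h3]; ring
  unfold envelope
  nlinarith [sq_nonneg (Y t)]

/-- Second order systems with the potential of the sphere. -/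
theorem SecondOrder.le_envelope_of_sphere {k B D a b ψ Y₀ κ : ℝ} {Ψ X Y c w' c' : ℝ → ℝ}
    (h : SecondOrder k B D a b Ψ X Y c w' c') (hk1 : 1 ≤ k) (hkB : 4 * B ≤ k) (hB : 0 ≤ B)
    (hψ : 0 < ψ) (hψ1 : ψ < 1)
    (hk0 : Y₀ ^ 2 + Y₀ + 256 * D ^ 2 / (1 - ψ) < k * (1 - ψ))
    (hκ : 16 / (1 - ψ) + 512 * D ^ 2 / (1 - ψ) ≤ κ)
    (hY : Y a ≤ Y₀) (hΨa : Ψ a ≤ ψ)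
    (hΨ : ∀ t ∈ Set.Icc a b, X t ^ 2 = Ψ t * (2 - Ψ t)) :
    ∀ t ∈ Set.Icc a b, k ^ 2 * X t ^ 2 + Y t ^ 2 ≤ envelope κ k (t - a) := by
  intro t ht
  have hk : 0 < k := by linarith
  have hμ : 0 < 1 - ψ := by linarith
  have ha : a ∈ Set.Icc a b := ⟨le_rfl, ht.1.trans ht.2⟩
  have hXa := h.X_nonneg a ha
  have hYa := h.Y_nonneg a ha
  have hΨ0 : ∀ t ∈ Set.Icc a b, 0 ≤ Ψ t := fun t ht => by
    have := h.X_sq_le t ht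
    nlinarith [sq_nonneg (X t)]
  have hX1 : X a ≤ 1 := by
    have := hΨ a ha
    nlinarith [sq_nonneg (Ψ a - 1)]
  have hkk : k ≤ k ^ 2 := by nlinarith
  -- All terms but `k ^ 2 * ψ` are at most linear in `k`, so the gap between `ψ` and `(1 + ψ) / 2`
  -- dominates them for large `k`.
  have hW0 : k ^ 2 * Ψ a + 1 / 2 * Y a ^ 2 + k / 2 * (X a * Y a) + 128 * D ^ 2 / ((1 - ψ) * k ^ 2)
      < 1 / 2 * k ^ 2 * (1 + ψ) := by
    have e1 : k ^ 2 * Ψ a ≤ k ^ 2 * ψ := by gcongr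
    have e2 : Y a ^ 2 ≤ k * Y₀ ^ 2 := by
      have : Y a ^ 2 ≤ Y₀ ^ 2 := by gcongr
      exact this.trans (le_mul_of_one_le_left (sq_nonneg _) hk1)
    have e3 : k / 2 * (X a * Y a) ≤ k / 2 * Y₀ := by
      gcongr
      exact (mul_le_of_le_one_left hYa hX1).trans hY
    have e4 : 128 * D ^ 2 / ((1 - ψ) * k ^ 2) ≤ k * (128 * D ^ 2 / (1 - ψ)) := by
      rw [← div_div]
      have h0 : 0 ≤ 128 * D ^ 2 / (1 - ψ) := by positivity
      calc 128 * D ^ 2 / (1 - ψ) / k ^ 2 ≤ 128 * D ^ 2 / (1 - ψ) := div_le_self h0 (by nlinarith)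
        _ ≤ _ := le_mul_of_one_le_left h0 hk1
    have e5 := mul_lt_mul_of_pos_left hk0 hk
    have e6 : 256 * D ^ 2 / (1 - ψ) = 2 * (128 * D ^ 2 / (1 - ψ)) := by ring
    rw [e6] at e5
    nlinarith
  -- Bootstrap away from the antipode. While `Ψ ≤ 1 + ψ`, the identity `X ^ 2 = Ψ * (2 - Ψ)` gives
  -- `X ^ 2 ≥ (1 - ψ) * Ψ`, so the energy estimate holds with `μ = 1 - ψ`. It bounds half of `k ^ 2
  -- * Ψ` by the quantity in `hW0`, which is where the threshold `1 + ψ` comes from.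
  have hE : ∀ t ∈ Set.Icc a b, Ψ t < 1 + ψ := by
    refine lt_of_continuousOn_of_bootstrap
      (fun t ht => (h.Ψ_deriv t ht).continuousWithinAt) (by linarith) ?_
    intro t ht hlt
    have hs : Set.Icc a t ⊆ Set.Icc a b := Set.Icc_subset_Icc_right ht.2
    have hen := (h.mono ht.2).energy_le hk hkB hB hμ (by linarith) (fun u hu => by
      rw [hΨ u (hs hu)]
      nlinarith [hlt u hu, hΨ0 u (hs hu)]) t ⟨ht.1, le_rfl⟩
    have hexp : Real.exp (-(k * (1 - ψ) / 16 * (t - a))) ≤ 1 := by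
      apply Real.exp_le_one_iff.2
      have := ht.1
      have : 0 ≤ k * (1 - ψ) / 16 * (t - a) := mul_nonneg (by positivity) (by linarith)
      linarith
    have h0 : 0 ≤ k ^ 2 * Ψ a + 1 / 2 * Y a ^ 2 + k / 2 * (X a * Y a) := by
      have := hΨ0 a ha
      positivity
    have h1 := mul_le_of_le_one_right h0 hexp
    have h2 : k ^ 2 * Ψ t < k ^ 2 * (1 + ψ) := by nlinarith [sq_nonneg (Y t)]
    exact lt_of_mul_lt_mul_left h2 (sq_nonneg k)
  have hen := h.energy_le hk hkB hB hμ (by linarith) (fun u hu => by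
      rw [hΨ u hu]
      nlinarith [hE u hu, hΨ0 u hu]) t ht
  have hD0 : 0 ≤ 512 * D ^ 2 / (1 - ψ) := by positivity
  have h16 : 16 ≤ 16 / (1 - ψ) := by
    rw [le_div_iff₀ hμ]; linarith
  have hκ0 : 0 < κ := by linarith
  have hexp : Real.exp (-(k * (1 - ψ) / 16 * (t - a))) ≤ Real.exp (-(k * (t - a) / κ)) := by
    apply Real.exp_le_exp.2
    have h0 : 0 ≤ k * (t - a) := mul_nonneg hk.le (by linarith [ht.1])
    have h1 : 1 / κ ≤ (1 - ψ) / 16 := by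
      rw [div_le_iff₀ hκ0]
      have : 16 / (1 - ψ) ≤ κ := by linarith
      rw [div_le_iff₀ hμ] at this
      linarith
    have h2 := mul_le_mul_of_nonneg_left h1 h0
    have h3 : k * (t - a) / κ = k * (t - a) * (1 / κ) := by ring
    rw [h3]
    linarith
  have h0 : k ^ 2 * Ψ a + 1 / 2 * Y a ^ 2 + k / 2 * (X a * Y a) ≤ k ^ 2 := by
    have : 0 ≤ 128 * D ^ 2 / ((1 - ψ) * k ^ 2) := by positivity
    nlinarith [sq_nonneg k]
  have h1 : (k ^ 2 * Ψ a + 1 / 2 * Y a ^ 2 + k / 2 * (X a * Y a))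
      * Real.exp (-(k * (1 - ψ) / 16 * (t - a))) ≤ k ^ 2 * Real.exp (-(k * (t - a) / κ)) := by
    gcongr
  have h2 : 4 * (128 * D ^ 2 / ((1 - ψ) * k ^ 2)) ≤ κ / k ^ 2 := by
    rw [← div_div, ← mul_div_assoc]
    gcongr
    have : 4 * (128 * D ^ 2 / (1 - ψ)) = 512 * D ^ 2 / (1 - ψ) := by ring
    rw [this]
    linarith [div_pos (by norm_num : (0 : ℝ) < 16) hμ]
  have h3 : k ^ 2 * X t ^ 2 ≤ 2 * (k ^ 2 * Ψ t) := by
    nlinarith [mul_le_mul_of_nonneg_left (h.X_sq_le t ht) (sq_nonneg k)]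
  have h4 : 4 * (k ^ 2 * Real.exp (-(k * (t - a) / κ)))
      ≤ κ * k ^ 2 * Real.exp (-(k * (t - a) / κ)) := by
    have : 4 * (k ^ 2 * Real.exp (-(k * (t - a) / κ)))
      ≤ κ * (k ^ 2 * Real.exp (-(k * (t - a) / κ))) := by
      gcongr; linarith
    linarith
  unfold envelope
  nlinarith [sq_nonneg (Y t)]

/-! ### Attitude error dynamics on the sphere -/

/-- The angular velocity error on the sphere. -/
def angErr (q ω ωd : E3) : E3 := ω + cross q (cross q ωd)

theorem angErr_eq {q : E3} (hq : ‖q‖ = 1) (ω ωd : E3) :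
    angErr q ω ωd = ω - ωd + ⟪q, ωd⟫_ℝ • q := by
  rw [angErr, cross_cross_self_of_unit hq]; abel

theorem inner_angErr_self {q ω : E3} (h : ⟪ω, q⟫_ℝ = 0) (ωd : E3) :
    ⟪angErr q ω ωd, q⟫_ℝ = 0 := by
  rw [angErr, inner_add_left, h, inner_cross_left_self, add_zero]

theorem norm_cross_cross_le {q : E3} (hq : ‖q‖ = 1) (w : E3) :
    ‖cross q (cross q w)‖ ≤ ‖cross q w‖ := by
  simpa [hq] using norm_cross_le q (cross q w)

/-- An attitude loop on `[a, b]` with gains `k ^ 2` and `2 * k`, bounded reference angular velocity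
`ωd`, bounded disturbance `d` and a gyroscopic perturbation with coefficient `σ`. -/
structure AttitudeLoop (k B D a b : ℝ) (q qd ω ωd d ω' ωd' : ℝ → E3) (σ : ℝ → ℝ) : Prop where
  q_unit : ∀ t ∈ Set.Icc a b, ‖q t‖ = 1
  qd_unit : ∀ t ∈ Set.Icc a b, ‖qd t‖ = 1
  ω_tangent : ∀ t ∈ Set.Icc a b, ⟪ω t, q t⟫_ℝ = 0
  q_kin : ∀ t ∈ Set.Icc a b, HasDerivWithinAt q (cross (ω t) (q t)) (Set.Icc a b) t
  qd_kin : ∀ t ∈ Set.Icc a b, HasDerivWithinAt qd (cross (ωd t) (qd t)) (Set.Icc a b) t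
  ω_deriv : ∀ t ∈ Set.Icc a b, HasDerivWithinAt ω (ω' t) (Set.Icc a b) t
  ωd_deriv : ∀ t ∈ Set.Icc a b, HasDerivWithinAt ωd (ωd' t) (Set.Icc a b) t
  ωd_le : ∀ t ∈ Set.Icc a b, ‖ωd t‖ ≤ B
  d_le : ∀ t ∈ Set.Icc a b, ‖d t‖ ≤ D
  σ_le : ∀ t ∈ Set.Icc a b, |σ t| ≤ 2 * B
  -- Tangential test vectors suffice, because both error vectors are orthogonal to `q t`.
  dyn : ∀ t ∈ Set.Icc a b, ∀ v, ⟪v, q t⟫_ℝ = 0 →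
    ⟪ω' t, v⟫_ℝ = ⟪ωd' t, v⟫_ℝ - ⟪q t, ωd t⟫_ℝ * ⟪cross (ω t) (q t), v⟫_ℝ
      - k ^ 2 * ⟪cross (qd t) (q t), v⟫_ℝ - 2 * k * ⟪angErr (q t) (ω t) (ωd t), v⟫_ℝ
      + ⟪d t, v⟫_ℝ + σ t * ⟪cross (q t) (angErr (q t) (ω t) (ωd t)), v⟫_ℝ

/-- The rate of the configuration error is the pairing of the two error vectors; hence the
proportional feedback cancels in the energy balance. -/
theorem deriv_config_identity {q : E3} (hq : ‖q‖ = 1) (qd ω ωd : E3) :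
    -(⟪qd, cross ω q⟫_ℝ + ⟪cross ωd qd, q⟫_ℝ) = ⟪cross qd q, angErr q ω ωd⟫_ℝ := by
  rw [angErr_eq hq, inner_add_right, inner_smul_right, inner_cross_right_self]
  simp only [inner_eq_coords, cross_coords, PiLp.sub_apply]
  ring

/-- Orthogonality of `q` to the velocity error removes all other terms of the expanded triple
products. The first remaining term is the effect of the moving reference, the second is at most the
squared velocity error. -/
theorem deriv_attErr_identity {q ω : E3} (hq : ‖q‖ = 1) (hω : ⟪ω, q⟫_ℝ = 0) (qd ωd : E3) :
    ⟪cross (cross ωd qd) q + cross qd (cross ω q), angErr q ω ωd⟫_ℝ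
      = ⟪ωd, q⟫_ℝ * ⟪qd, angErr q ω ωd⟫_ℝ + ⟪qd, q⟫_ℝ * ‖angErr q ω ωd‖ ^ 2 := by
  have h0 : ⟪q, angErr q ω ωd⟫_ℝ = 0 := by
    rw [real_inner_comm]; exact inner_angErr_self hω ωd
  have h1 : ‖angErr q ω ωd‖ ^ 2 = ⟪ω, angErr q ω ωd⟫_ℝ - ⟪ωd, angErr q ω ωd⟫_ℝ := by
    rw [← real_inner_self_eq_norm_sq]
    nth_rewrite 1 [angErr_eq hq]
    rw [inner_add_left, inner_smul_left, inner_sub_left, h0]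
    simp
  rw [h1, cross_cross_left, cross_cross_right]
  simp only [inner_add_left, inner_sub_left, inner_smul_left, conj_trivial]
  rw [h0]
  ring

/-- Only the part of `qd` tangent at `q` pairs with `e`, and its norm is that of the attitude error.
-/
theorem abs_inner_tangent_le {q e : E3} (hq : ‖q‖ = 1) (he : ⟪e, q⟫_ℝ = 0) (qd : E3) :
    |⟪qd, e⟫_ℝ| ≤ ‖cross qd q‖ * ‖e‖ := by
  have h1 : ⟪qd, e⟫_ℝ = -⟪cross q (cross q qd), e⟫_ℝ := by
    rw [cross_cross_self_of_unit hq, inner_sub_left, inner_smul_left, real_inner_comm e q, he]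
    simp
  rw [h1, abs_neg]
  refine (abs_real_inner_le_norm _ _).trans ?_
  gcongr
  refine (norm_cross_cross_le hq qd).trans ?_
  rw [cross_anticomm', norm_neg]

theorem AttitudeLoop.hasDerivWithinAt_angErr {k B D a b : ℝ} {q qd ω ωd d ω' ωd' : ℝ → E3}
    {σ : ℝ → ℝ} (h : AttitudeLoop k B D a b q qd ω ωd d ω' ωd' σ) {t : ℝ}
    (ht : t ∈ Set.Icc a b) :
    HasDerivWithinAt (fun t => angErr (q t) (ω t) (ωd t))
      (ω' t - ωd' t + (⟪q t, ωd t⟫_ℝ • cross (ω t) (q t)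
        + (⟪q t, ωd' t⟫_ℝ + ⟪cross (ω t) (q t), ωd t⟫_ℝ) • q t)) (Set.Icc a b) t := by
  have h1 := ((h.ω_deriv t ht).sub (h.ωd_deriv t ht)).add
    (((h.q_kin t ht).inner ℝ (h.ωd_deriv t ht)).smul (h.q_kin t ht))
  refine h1.congr (fun s hs => ?_) ?_
  · exact angErr_eq (h.q_unit s hs) _ _
  · exact angErr_eq (h.q_unit t ht) _ _

/-- The feedforward terms of `dyn` cancel the motion of the reference, and everything along `q` is
invisible to a tangential `v`. -/
theorem AttitudeLoop.inner_deriv_angErr {k B D a b : ℝ} {q qd ω ωd d ω' ωd' : ℝ → E3}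
    {σ : ℝ → ℝ} (h : AttitudeLoop k B D a b q qd ω ωd d ω' ωd' σ) {t : ℝ}
    (ht : t ∈ Set.Icc a b) {v : E3} (hv : ⟪v, q t⟫_ℝ = 0) :
    ⟪ω' t - ωd' t + (⟪q t, ωd t⟫_ℝ • cross (ω t) (q t)
        + (⟪q t, ωd' t⟫_ℝ + ⟪cross (ω t) (q t), ωd t⟫_ℝ) • q t), v⟫_ℝ
      = -k ^ 2 * ⟪cross (qd t) (q t), v⟫_ℝ - 2 * k * ⟪angErr (q t) (ω t) (ωd t), v⟫_ℝ
      + ⟪d t, v⟫_ℝ + σ t * ⟪cross (q t) (angErr (q t) (ω t) (ωd t)), v⟫_ℝ := by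
  have h1 := h.dyn t ht v hv
  have h2 : ⟪q t, v⟫_ℝ = 0 := by rw [real_inner_comm]; exact hv
  simp only [inner_add_left, inner_sub_left, inner_smul_left, conj_trivial, h2, h1]
  ring

/-- The error norms of an attitude loop form a second order error system. -/
theorem AttitudeLoop.exists_secondOrder {k B D a b : ℝ} {q qd ω ωd d ω' ωd' : ℝ → E3} {σ : ℝ → ℝ}
    (h : AttitudeLoop k B D a b q qd ω ωd d ω' ωd' σ) :
    ∃ w' c' : ℝ → ℝ, SecondOrder k (3 * B) D a b (fun t => 1 - ⟪qd t, q t⟫_ℝ)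
      (fun t => ‖cross (qd t) (q t)‖) (fun t => ‖angErr (q t) (ω t) (ωd t)‖)
      (fun t => ⟪cross (qd t) (q t), angErr (q t) (ω t) (ωd t)⟫_ℝ) w' c' := by
  have hsq : ∀ t ∈ Set.Icc a b, ‖cross (qd t) (q t)‖ ^ 2
      = (1 - ⟪qd t, q t⟫_ℝ) * (2 - (1 - ⟪qd t, q t⟫_ℝ)) := fun t ht => by
    rw [norm_cross_sq, h.q_unit t ht, h.qd_unit t ht]; ring
  refine ⟨_, _, fun t _ => norm_nonneg _, fun t _ => norm_nonneg _, fun t ht => ?_,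
    fun t _ => abs_real_inner_le_norm _ _, fun t ht => ?_,
    fun t ht => (h.hasDerivWithinAt_angErr ht).norm_sq,
    fun t ht => (hasDerivWithinAt_cross (h.qd_kin t ht) (h.q_kin t ht)).inner ℝ
      (h.hasDerivWithinAt_angErr ht), fun t ht => ?_, fun t ht => ?_⟩
  · rw [hsq t ht]
    nlinarith [sq_nonneg (1 - ⟪qd t, q t⟫_ℝ)]
  · rw [← deriv_config_identity (h.q_unit t ht)]
    exact ((h.qd_kin t ht).inner ℝ (h.q_kin t ht)).const_sub 1
  · have he := inner_angErr_self (h.ω_tangent t ht) (ωd t)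
    -- The gyroscopic perturbation is orthogonal to the velocity error and does no work.
    rw [real_inner_comm, h.inner_deriv_angErr ht he, inner_cross_right_self,
      real_inner_self_eq_norm_sq]
    have h1 := (real_inner_le_norm (d t) (angErr (q t) (ω t) (ωd t))).trans
      (mul_le_mul_of_nonneg_right (h.d_le t ht) (norm_nonneg _))
    linarith
  · have he := inner_angErr_self (h.ω_tangent t ht) (ωd t)
    rw [real_inner_comm, h.inner_deriv_angErr ht (inner_cross_right_self _ _),
      deriv_attErr_identity (h.q_unit t ht) (h.ω_tangent t ht), real_inner_self_eq_norm_sq,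
      real_inner_comm (cross (qd t) (q t)) (angErr (q t) (ω t) (ωd t))]
    -- The coefficient `3 * B` is composed of `B` from the moving reference (`h3`) and `2 * B` from
    -- the gyroscopic term (`h4`).
    have hB : 0 ≤ B := (norm_nonneg _).trans (h.ωd_le t ht)
    have h1 := (real_inner_le_norm (d t) (cross (qd t) (q t))).trans
      (mul_le_mul_of_nonneg_right (h.d_le t ht) (norm_nonneg _))
    have h2 : ⟪qd t, q t⟫_ℝ * ‖angErr (q t) (ω t) (ωd t)‖ ^ 2
        ≤ ‖angErr (q t) (ω t) (ωd t)‖ ^ 2 := by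
      refine mul_le_of_le_one_left (sq_nonneg _) ?_
      simpa [h.q_unit t ht, h.qd_unit t ht] using real_inner_le_norm (qd t) (q t)
    have h3 : ⟪ωd t, q t⟫_ℝ * ⟪qd t, angErr (q t) (ω t) (ωd t)⟫_ℝ
        ≤ B * (‖cross (qd t) (q t)‖ * ‖angErr (q t) (ω t) (ωd t)‖) := by
      refine (le_abs_self _).trans ?_
      rw [abs_mul]
      refine mul_le_mul ?_ (abs_inner_tangent_le (h.q_unit t ht) he _) (abs_nonneg _) hB
      refine (abs_real_inner_le_norm _ _).trans ?_
      simpa [h.q_unit t ht] using h.ωd_le t ht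
    have h4 : σ t * ⟪cross (q t) (angErr (q t) (ω t) (ωd t)), cross (qd t) (q t)⟫_ℝ
        ≤ 2 * B * (‖cross (qd t) (q t)‖ * ‖angErr (q t) (ω t) (ωd t)‖) := by
      refine (le_abs_self _).trans ?_
      rw [abs_mul]
      refine mul_le_mul (h.σ_le t ht) ?_ (abs_nonneg _) (by positivity)
      refine (abs_real_inner_le_norm _ _).trans ?_
      rw [mul_comm]
      gcongr
      simpa [h.q_unit t ht] using norm_cross_le (q t) (angErr (q t) (ω t) (ωd t))
    linarith

/-- For all large gain parameters, the errors of an attitude loop that starts in the sublevel set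
`ψ < 1` of the configuration error stay below an exponentially decaying envelope. -/
theorem exists_gain_attitudeLoop {ψ : ℝ} (hψ : 0 < ψ) (hψ1 : ψ < 1) (Y₀ B D : ℝ) :
    ∃ k₀ κ : ℝ, 1 ≤ k₀ ∧ 0 < κ ∧ ∀ k, k₀ ≤ k → ∀ (a b : ℝ) (q qd ω ωd d ω' ωd' : ℝ → E3)
      (σ : ℝ → ℝ), AttitudeLoop k B D a b q qd ω ωd d ω' ωd' σ →
      ‖angErr (q a) (ω a) (ωd a)‖ ≤ Y₀ → 1 - ⟪qd a, q a⟫_ℝ ≤ ψ →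
      ∀ t ∈ Set.Icc a b, k ^ 2 * ‖cross (qd t) (q t)‖ ^ 2 + ‖angErr (q t) (ω t) (ωd t)‖ ^ 2
        ≤ envelope κ k (t - a) := by
  have hμ : 0 < 1 - ψ := by linarith
  -- The entry `12 * B` is `4 * (3 * B)`, and the summand 1 in the last entry makes the gain
  -- condition strict.
  refine ⟨max 1 (max (12 * B) ((Y₀ ^ 2 + Y₀ + 256 * D ^ 2 / (1 - ψ) + 1) / (1 - ψ))),
    16 / (1 - ψ) + 512 * D ^ 2 / (1 - ψ), le_max_left _ _, by positivity, ?_⟩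
  intro k hk a b q qd ω ωd d ω' ωd' σ h hY hΨ t ht
  obtain ⟨w', c', hso⟩ := h.exists_secondOrder
  have hk1 : 1 ≤ k := (le_max_left _ _).trans hk
  have hk2 : 12 * B ≤ k := (le_max_left _ _).trans ((le_max_right _ _).trans hk)
  have hk3 : (Y₀ ^ 2 + Y₀ + 256 * D ^ 2 / (1 - ψ) + 1) / (1 - ψ) ≤ k :=
    (le_max_right _ _).trans ((le_max_right _ _).trans hk)
  have hB : 0 ≤ B := (norm_nonneg _).trans (h.ωd_le t ht)
  rw [div_le_iff₀ hμ] at hk3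
  refine hso.le_envelope_of_sphere hk1 (by linarith) (by positivity) hψ hψ1 (by linarith) le_rfl
    hY hΨ (fun t ht => ?_) t ht
  rw [norm_cross_sq, h.q_unit t ht, h.qd_unit t ht]
  ring

/-! ### Position error dynamics -/

/-- Here the potential is exactly quadratic and there is no moving frame, so `μ = 1` and `B = 0`:
every `k ≥ 1` is admissible, from any initial ball. -/
theorem exists_gain_positionLoop (X₀ Y₀ D : ℝ) :
    ∃ κ : ℝ, 0 < κ ∧ ∀ k, 1 ≤ k → ∀ (a b : ℝ) (x v d : ℝ → E3),
      (∀ t ∈ Set.Icc a b, HasDerivWithinAt x (v t) (Set.Icc a b) t) →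
      (∀ t ∈ Set.Icc a b, HasDerivWithinAt v (-((2 * k) • v t) - k ^ 2 • x t + d t)
        (Set.Icc a b) t) →
      (∀ t ∈ Set.Icc a b, ‖d t‖ ≤ D) → ‖x a‖ ≤ X₀ → ‖v a‖ ≤ Y₀ →
      ∀ t ∈ Set.Icc a b, k ^ 2 * ‖x t‖ ^ 2 + ‖v t‖ ^ 2 ≤ envelope κ k (t - a) := by
  refine ⟨4 * (X₀ ^ 2 + Y₀ ^ 2) + 16 + 512 * D ^ 2, by positivity, ?_⟩
  intro k hk a b x v d hx hv hd hX hY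
  have hso : SecondOrder k 0 D a b (fun t => 1 / 2 * ‖x t‖ ^ 2) (fun t => ‖x t‖)
      (fun t => ‖v t‖) (fun t => ⟪x t, v t⟫_ℝ)
      (fun t => 2 * ⟪v t, -((2 * k) • v t) - k ^ 2 • x t + d t⟫_ℝ)
      (fun t => ⟪x t, -((2 * k) • v t) - k ^ 2 • x t + d t⟫_ℝ + ⟪v t, v t⟫_ℝ) := by
    refine ⟨fun t _ => norm_nonneg _, fun t _ => norm_nonneg _, fun t _ => by linarith,
      fun t _ => abs_real_inner_le_norm _ _, fun t ht => ?_, fun t ht => (hv t ht).norm_sq,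
      fun t ht => (hx t ht).inner ℝ (hv t ht), fun t ht => ?_, fun t ht => ?_⟩
    · exact (((hx t ht).norm_sq).const_mul (1 / 2 : ℝ)).congr_deriv (by ring)
    · have h1 := (real_inner_le_norm (v t) (d t)).trans
        (mul_le_mul_of_nonneg_left (hd t ht) (norm_nonneg _))
      simp only [inner_add_right, inner_sub_right, inner_neg_right, inner_smul_right,
        real_inner_self_eq_norm_sq]
      rw [real_inner_comm (x t) (v t)]
      linarith
    · have h1 := (real_inner_le_norm (x t) (d t)).trans
        (mul_le_mul_of_nonneg_left (hd t ht) (norm_nonneg _))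
      simp only [inner_add_right, inner_sub_right, inner_neg_right, inner_smul_right,
        real_inner_self_eq_norm_sq]
      linarith
  exact hso.le_envelope_of_quadratic hk (by linarith) le_rfl le_rfl hX hY (fun t _ => by ring)

/-! ### The envelope -/

theorem envelope_le {κ k s : ℝ} (hκ : 0 < κ) (hk : 1 ≤ k) (hs : 0 ≤ s) :
    envelope κ k s ≤ κ * k ^ 2 + κ := by
  have h1 : Real.exp (-(k * s / κ)) ≤ 1 := by
    apply Real.exp_le_one_iff.2
    have : 0 ≤ k * s / κ := by positivity
    linarith
  have h2 : κ / k ^ 2 ≤ κ := div_le_self hκ.le (by nlinarith)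
  have h3 := mul_le_of_le_one_right (by positivity : 0 ≤ κ * k ^ 2) h1
  unfold envelope
  linarith

open Filter Topology in
/-- The envelope is ultimately as small as its disturbance term. -/
theorem exists_time_envelope_le {κ k η : ℝ} (hκ : 0 < κ) (hk : 1 ≤ k) (hη : 0 < η)
    (h : κ / k ^ 2 ≤ η) : ∃ T, 0 ≤ T ∧ ∀ s, T ≤ s → envelope κ k s ≤ 2 * η := by
  have h1 : Tendsto (fun s : ℝ => κ * k ^ 2 * Real.exp (-(k * s / κ))) atTop (𝓝 0) := by
    have h2 : Tendsto (fun s : ℝ => k * s / κ) atTop atTop :=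
      (tendsto_id.const_mul_atTop (by linarith)).atTop_div_const hκ
    simpa using (Real.tendsto_exp_neg_atTop_nhds_zero.comp h2).const_mul (κ * k ^ 2)
  obtain ⟨T, hT⟩ := eventually_atTop.1 (h1.eventually (ge_mem_nhds hη))
  refine ⟨max T 0, le_max_right _ _, fun s hs => ?_⟩
  have := hT s ((le_max_left _ _).trans hs)
  unfold envelope
  linarith

open Filter Topology in
/-- For large gains, the attitude error is small from the time `τ` on. -/
theorem eventually_envelope_le {κ τ ε : ℝ} (hκ : 0 < κ) (hτ : 0 < τ) (hε : 0 < ε) :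
    ∀ᶠ k in atTop, ∀ s, τ ≤ s → envelope κ k s ≤ k ^ 2 * ε := by
  -- The initial peak of the envelope is of order `k ^ 2`, the same order as the weight of the
  -- configuration error, so it is harmless after division by `k ^ 2`.
  have h1 : Tendsto (fun k : ℝ => κ * Real.exp (-(k * τ / κ)) + κ / k ^ 4) atTop (𝓝 0) := by
    have h2 : Tendsto (fun k : ℝ => k * τ / κ) atTop atTop :=
      (tendsto_id.atTop_mul_const hτ).atTop_div_const hκ
    have h3 := (Real.tendsto_exp_neg_atTop_nhds_zero.comp h2).const_mul κ
    have h4 : Tendsto (fun k : ℝ => κ / k ^ 4) atTop (𝓝 0) :=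
      tendsto_const_nhds.div_atTop (tendsto_pow_atTop (by norm_num))
    simpa using h3.add h4
  filter_upwards [h1.eventually (ge_mem_nhds hε), eventually_ge_atTop 1] with k hk hk1 s hs
  have h5 : Real.exp (-(k * s / κ)) ≤ Real.exp (-(k * τ / κ)) := by
    apply Real.exp_le_exp.2
    have : k * τ / κ ≤ k * s / κ := by gcongr
    linarith
  have h6 : envelope κ k s ≤ k ^ 2 * (κ * Real.exp (-(k * τ / κ)) + κ / k ^ 4) := by
    have : κ / k ^ 2 = k ^ 2 * (κ / k ^ 4) := by field_simp
    unfold envelope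
    rw [this, mul_add]
    gcongr ?_ + _
    calc κ * k ^ 2 * Real.exp (-(k * s / κ)) ≤ κ * k ^ 2 * Real.exp (-(k * τ / κ)) := by gcongr
      _ = _ := by ring
  exact h6.trans (by gcongr)

open Filter Topology in
theorem eventually_div_sq_le {κ η : ℝ} (hη : 0 < η) : ∀ᶠ k : ℝ in atTop, κ / k ^ 2 ≤ η :=
  (tendsto_const_nhds.div_atTop (tendsto_pow_atTop (by norm_num))).eventually (ge_mem_nhds hη)

/-! ### Regularity of the reference -/

theorem Reference.hasDerivAt_xd (r : Reference) (t : ℝ) :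
    HasDerivAt r.xd (velDes r.xd t) t :=
  (r.xd_smooth.differentiable (by norm_num) t).hasDerivAt

theorem Reference.contDiff_velDes (r : Reference) : ContDiff ℝ 3 (velDes r.xd) :=
  ((contDiff_succ_iff_deriv (n := 3)).1 (by simpa using! r.xd_smooth)).2.2

theorem Reference.hasDerivAt_velDes (r : Reference) (t : ℝ) :
    HasDerivAt (velDes r.xd) (deriv (velDes r.xd) t) t :=
  (r.contDiff_velDes.differentiable (by norm_num) t).hasDerivAt

theorem Reference.hasDerivAt_deriv_velDes (r : Reference) (t : ℝ) :
    HasDerivAt (deriv (velDes r.xd)) (deriv (deriv (velDes r.xd)) t) t := by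
  have h : ContDiff ℝ 2 (deriv (velDes r.xd)) :=
    ((contDiff_succ_iff_deriv (n := 2)).1 (by simpa using! r.contDiff_velDes)).2.2
  exact (h.differentiable (by norm_num) t).hasDerivAt

theorem Reference.contDiff_angVel (r : Reference) : ContDiff ℝ 3 (angVel r.qd) := by
  have h : ContDiff ℝ 3 (deriv r.qd) :=
    ((contDiff_succ_iff_deriv (n := 3)).1 (by simpa using! r.qd_smooth)).2.2
  have h1 : ContDiff ℝ 3 r.qd := r.qd_smooth.of_le (by norm_num)
  exact (crossCLM.contDiff.comp h1).clm_apply h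

theorem Reference.hasDerivAt_angVel (r : Reference) (t : ℝ) :
    HasDerivAt (angVel r.qd) (deriv (angVel r.qd) t) t :=
  (r.contDiff_angVel.differentiable (by norm_num) t).hasDerivAt

theorem Reference.hasDerivAt_deriv_angVel (r : Reference) (t : ℝ) :
    HasDerivAt (deriv (angVel r.qd)) (deriv (deriv (angVel r.qd)) t) t := by
  have h : ContDiff ℝ 2 (deriv (angVel r.qd)) :=
    ((contDiff_succ_iff_deriv (n := 2)).1 (by simpa using! r.contDiff_angVel)).2.2
  exact (h.differentiable (by norm_num) t).hasDerivAt

theorem Reference.hasDerivAt_qd (r : Reference) (t : ℝ) :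
    HasDerivAt r.qd (cross (angVel r.qd t) (r.qd t)) t := by
  have h := (r.qd_smooth.differentiable (by norm_num) t).hasDerivAt
  have h0 : ⟪r.qd t, deriv r.qd t⟫_ℝ = 0 :=
    inner_deriv_eq_zero_of_unit (J := Set.univ) (Set.mem_univ t) uniqueDiffWithinAt_univ
      (fun s _ => r.qd_unit s) h.hasDerivWithinAt
  rwa [angVel, cross_angular_velocity (r.qd_unit t) h0]

/-! ### Rod error dynamics -/

/-- The deviation of the applied cable force from the desired one. -/
def muErr (p : Params) (K : RodGains) (r : Reference) (s : Motion) (j : Fin 2) (t : ℝ) : E3 :=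
  cross (s.q j t) (cross (s.q j t) (muDes p K r s j t))

/-- The desired force is antiparallel to `qDes`, so its component orthogonal to the cable is
measured by the attitude error of the cable. This is the only coupling from the cables to the rod.
-/
theorem norm_muErr_le {p : Params} {K : RodGains} {r : Reference} {s : Motion} {j : Fin 2} {t : ℝ}
    (hq : ‖s.q j t‖ = 1) (hμ : muDes p K r s j t ≠ 0) :
    ‖muErr p K r s j t‖ ≤ ‖muDes p K r s j t‖ * ‖eqc p K r s j t‖ := by
  have h : muDes p K r s j t = -(‖muDes p K r s j t‖ • qDes p K r s j t) := by
    rw [qDes, smul_neg, neg_neg, smul_smul, mul_inv_cancel₀ (norm_ne_zero_iff.2 hμ), one_smul]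
  refine (norm_cross_cross_le hq _).trans ?_
  nth_rewrite 1 [h]
  rw [cross_neg_right, cross_smul_right, norm_neg, norm_smul, norm_norm, cross_anticomm', norm_neg]
  rfl

theorem sgn_zero : sgn 0 = -1 := if_pos rfl

theorem sgn_one : sgn 1 = 1 := if_neg (by decide)

theorem muDes_add (p : Params) (K : RodGains) (r : Reference) (s : Motion) (t : ℝ) :
    muDes p K r s 0 t + muDes p K r s 1 t = muSum p K r s t := by
  simp only [muDes, sgn_zero, sgn_one]
  module

theorem muDes_sub (p : Params) (K : RodGains) (r : Reference) (s : Motion) (t : ℝ) :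
    muDes p K r s 1 t - muDes p K r s 0 t = muDiff p K r s t := by
  simp only [muDes, sgn_zero, sgn_one]
  module

section Loops

variable {p : Params} {K : RodGains} {C : CableGains} {r : Reference} {s : Motion}
  {d : Disturbance} {J : Set ℝ}

theorem IsSolution.hasDerivWithinAt_ex (h : IsSolution p K C r s d J) {t : ℝ} (ht : t ∈ J) :
    HasDerivWithinAt (ex r s) (ev r s t) J t :=
  (h.x_kin t ht).sub (r.hasDerivAt_xd t).hasDerivWithinAt

theorem IsSolution.hasDerivWithinAt_ev (h : IsSolution p K C r s d J) {t : ℝ} (ht : t ∈ J) :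
    HasDerivWithinAt (ev r s) (derivWithin s.v J t - deriv (velDes r.xd) t) J t :=
  (h.v_diff t ht).hasDerivWithinAt.sub (r.hasDerivAt_velDes t).hasDerivWithinAt

theorem IsSolution.acc_error_eq (h : IsSolution p K C r s d J) {t : ℝ} (ht : t ∈ J) :
    derivWithin s.v J t - deriv (velDes r.xd) t = -(K.kv • ev r s t) - K.kx • ex r s t
      + p.mr⁻¹ • (muErr p K r s 0 t + muErr p K r s 1 t + d.x t) := by
  have hm := p.mr_pos.ne'
  have h1 := h.v_dyn t ht
  have h2 : mu p K r s 0 t + mu p K r s 1 t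
      = muSum p K r s t + (muErr p K r s 0 t + muErr p K r s 1 t) := by
    rw [← muDes_add, mu, mu, muErr, muErr]; abel
  rw [h2, muSum] at h1
  have h3 : derivWithin s.v J t + p.g • e3
      = (deriv (velDes r.xd) t + p.g • e3 - K.kv • ev r s t - K.kx • ex r s t)
        + p.mr⁻¹ • (muErr p K r s 0 t + muErr p K r s 1 t + d.x t) := by
    rw [← inv_smul_smul₀ hm (derivWithin s.v J t + p.g • e3), h1, add_assoc, smul_add,
      inv_smul_smul₀ hm]
  rw [eq_sub_of_add_eq h3]
  abel

/-- The disturbance of the rod attitude loop. -/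
def rodDist (p : Params) (K : RodGains) (r : Reference) (s : Motion) (d : Disturbance) (t : ℝ) :
    E3 :=
  (2 / 3 * p.mr * p.Lr)⁻¹ • (cross (s.qr t) (muErr p K r s 1 t - muErr p K r s 0 t) + d.qr t)
    + (2 * ⟪s.qr t, angVel r.qd t⟫_ℝ) • cross (angVel r.qd t) (s.qr t)

/-- The term with `cross (s.qr t) (s.ωr t)` has the sign opposite to the one in `AttitudeLoop.dyn`.
The mismatch, twice this term, splits into a multiple of `cross (s.qr t) (eωr r s t)`, the
gyroscopic perturbation in `rodLoop`, and a part with the bounded reference velocity, the last term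
of `rodDist`. -/
theorem IsSolution.ωr_deriv_eq (h : IsSolution p K C r s d J) {t : ℝ} (ht : t ∈ J) :
    derivWithin s.ωr J t =
      (-cross (s.qr t) (cross (s.qr t) (deriv (angVel r.qd) t))
        - ⟪s.qr t, angVel r.qd t⟫_ℝ • cross (s.qr t) (s.ωr t)
        + K.kω • cross (s.qr t) (cross (s.qr t) (eωr r s t))
        + K.kq • cross (s.qr t) (cross (s.qr t) (eqr r s t)))
      + (2 / 3 * p.mr * p.Lr)⁻¹ • (cross (s.qr t) (muErr p K r s 1 t - muErr p K r s 0 t)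
        + d.qr t) := by
  have hI : 2 / 3 * p.mr * p.Lr ≠ 0 := by
    have := p.mr_pos; have := p.Lr_pos; positivity
  have h1 := h.ωr_dyn t ht
  have h2 : mu p K r s 1 t - mu p K r s 0 t
      = muDiff p K r s t + (muErr p K r s 1 t - muErr p K r s 0 t) := by
    rw [← muDes_sub, mu, mu, muErr, muErr]; abel
  rw [h2, cross_add_right, muDiff, cross_smul_right, add_assoc] at h1
  have h3 := congrArg (fun w => (2 / 3 * p.mr * p.Lr)⁻¹ • w) h1
  simp only [smul_add, inv_smul_smul₀ hI] at h3
  rw [h3, smul_add]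
  congr 1
  have h4 : ⟪s.qr t, angVel r.qd t⟫_ℝ • cross (s.qr t) (cross (s.qr t) (angVel r.qd t))
      - ⟪s.qr t, angVel r.qd t⟫_ℝ • eωr r s t = -(⟪s.qr t, angVel r.qd t⟫_ℝ • s.ωr t) := by
    rw [eωr, smul_add]; abel
  rw [add_sub_assoc, h4]
  simp only [cross_add_right, cross_neg_right, cross_smul_right]
  abel

/-- The rod attitude errors obey an attitude loop. -/
theorem IsSolution.rodLoop (h : IsSolution p K C r s d J) {k B D a b : ℝ} (hkq : K.kq = k ^ 2)
    (hkω : K.kω = 2 * k) (hab : Set.Icc a b ⊆ J)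
    (hB : ∀ t ∈ Set.Icc a b, ‖angVel r.qd t‖ ≤ B)
    (hD : ∀ t ∈ Set.Icc a b, ‖rodDist p K r s d t‖ ≤ D) :
    AttitudeLoop k B D a b s.qr r.qd s.ωr (angVel r.qd) (rodDist p K r s d) (derivWithin s.ωr J)
      (deriv (angVel r.qd)) (fun t => -2 * ⟪s.qr t, angVel r.qd t⟫_ℝ) where
  q_unit t ht := h.qr_unit t (hab ht)
  qd_unit t _ := r.qd_unit t
  ω_tangent t ht := h.ωr_tangent t (hab ht)
  q_kin t ht := (h.qr_kin t (hab ht)).mono hab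
  qd_kin t _ := (r.hasDerivAt_qd t).hasDerivWithinAt
  ω_deriv t ht := (h.ωr_diff t (hab ht)).hasDerivWithinAt.mono hab
  ωd_deriv t _ := (r.hasDerivAt_angVel t).hasDerivWithinAt
  ωd_le := hB
  d_le := hD
  σ_le t ht := by
    rw [abs_mul, abs_neg, abs_two]
    gcongr
    refine (abs_real_inner_le_norm _ _).trans ?_
    rw [h.qr_unit t (hab ht), one_mul]
    exact hB t ht
  dyn t ht v hv := by
    have hu := h.qr_unit t (hab ht)
    have hv' : ⟪s.qr t, v⟫_ℝ = 0 := by rw [real_inner_comm]; exact hv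
    have e1 : angErr (s.qr t) (s.ωr t) (angVel r.qd t) = eωr r s t := rfl
    have e2 : cross (r.qd t) (s.qr t) = eqr r s t := rfl
    have e3 : cross (s.qr t) (eωr r s t)
        = -cross (s.ωr t) (s.qr t) + cross (angVel r.qd t) (s.qr t) := by
      rw [← e1, angErr_eq hu, cross_add_right, cross_smul_right, cross_self', cross_sub_right,
        cross_anticomm' (s.qr t) (s.ωr t), cross_anticomm' (s.qr t) (angVel r.qd t)]
      module
    rw [h.ωr_deriv_eq (hab ht), e1, e2, cross_cross_self_of_unit hu (eωr r s t), e3, rodDist, hkq, hkω, cross_anticomm' (s.qr t) (s.ωr t)]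
    simp only [cross_cross_self_of_unit hu, inner_add_left, inner_sub_left, inner_smul_left,
      inner_neg_left, conj_trivial, hv']
    ring

/-! ### Cable error dynamics -/

/-- The factor 2 counts the change of the vector and the change of its norm. Division by `‖f t‖` is
the reason why the desired forces must stay away from zero. -/
theorem hasDerivWithinAt_inv_norm_smul {f : ℝ → E3} {f' : E3} {t : ℝ}
    (hf : HasDerivWithinAt f f' J t) (h0 : f t ≠ 0) :
    ∃ g', HasDerivWithinAt (fun t => -(‖f t‖⁻¹ • f t)) g' J t ∧ ‖g'‖ ≤ 2 * ‖f'‖ / ‖f t‖ := by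
  have hn : ‖f t‖ ≠ 0 := norm_ne_zero_iff.2 h0
  have hp : 0 < ‖f t‖ := norm_pos_iff.2 h0
  have h1 : HasDerivWithinAt (fun t => ‖f t‖) (⟪f t, f'⟫_ℝ / ‖f t‖) J t := by
    have h2 := hf.norm_sq.sqrt (pow_ne_zero 2 hn)
    simp only [Real.sqrt_sq (norm_nonneg _)] at h2
    exact h2.congr_deriv (by field_simp)
  refine ⟨_, ((h1.inv hn).smul hf).neg, ?_⟩
  rw [norm_neg]
  refine (norm_add_le _ _).trans ?_
  rw [norm_smul, norm_smul, Pi.inv_apply, norm_inv, norm_norm, norm_div, norm_neg, norm_div, norm_pow, norm_norm]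
  have h3 : ‖⟪f t, f'⟫_ℝ‖ ≤ ‖f t‖ * ‖f'‖ := norm_inner_le_norm _ _
  have h4 : ‖⟪f t, f'⟫_ℝ‖ / ‖f t‖ / ‖f t‖ ^ 2 * ‖f t‖ ≤ ‖f'‖ / ‖f t‖ := by
    calc ‖⟪f t, f'⟫_ℝ‖ / ‖f t‖ / ‖f t‖ ^ 2 * ‖f t‖
        ≤ (‖f t‖ * ‖f'‖) / ‖f t‖ / ‖f t‖ ^ 2 * ‖f t‖ := by gcongr
      _ = _ := by field_simp
  have h5 : ‖f t‖⁻¹ * ‖f'‖ = ‖f'‖ / ‖f t‖ := by ring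
  have h6 : 2 * ‖f'‖ / ‖f t‖ = ‖f'‖ / ‖f t‖ + ‖f'‖ / ‖f t‖ := by ring
  linarith

theorem norm_qDes {j : Fin 2} {t : ℝ} (h : muDes p K r s j t ≠ 0) :
    ‖qDes p K r s j t‖ = 1 := by
  rw [qDes, norm_neg, norm_smul, norm_inv, norm_norm, inv_mul_cancel₀ (norm_ne_zero_iff.2 h)]

/-- The desired cable attitudes are transported by their angular velocities, which are controlled by
the rate of change of the desired cable forces. -/
theorem IsSolution.qDes_kin (h : IsSolution p K C r s d J) {j : Fin 2} {t : ℝ} (ht : t ∈ J)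
    (hJ : UniqueDiffWithinAt ℝ J t) {M m₀ : ℝ} {μ' : E3} (hm : 0 < m₀)
    (hμ : HasDerivWithinAt (muDes p K r s j) μ' J t) (hM : ‖μ'‖ ≤ M)
    (hm₀ : m₀ ≤ ‖muDes p K r s j t‖) :
    HasDerivWithinAt (qDes p K r s j) (cross (ωDes p K r s J j t) (qDes p K r s j t)) J t ∧
      ‖ωDes p K r s J j t‖ ≤ 2 * M / m₀ := by
  obtain ⟨g', hg, hg'⟩ := hasDerivWithinAt_inv_norm_smul hμ (h.muDes_ne j t ht)
  change HasDerivWithinAt (qDes p K r s j) g' J t at hg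
  have hunit : ∀ t ∈ J, ‖qDes p K r s j t‖ = 1 := fun t ht => norm_qDes (h.muDes_ne j t ht)
  have h0 := inner_deriv_eq_zero_of_unit ht hJ hunit hg
  rw [ωDes, hg.derivWithin hJ, cross_angular_velocity (hunit t ht) h0]
  refine ⟨hg, (norm_cross_le _ _).trans ?_⟩
  rw [hunit t ht, one_mul]
  refine hg'.trans ?_
  have := (norm_nonneg _).trans hM
  gcongr

theorem cross_uPar {J : Set ℝ} {j : Fin 2} {t : ℝ} (hq : ‖s.q j t‖ = 1) :
    cross (s.q j t) (uPar p K r s J j t) = 0 := by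
  have h1 : cross (s.q j t) (mu p K r s j t) = 0 := by
    rw [mu, cross_cross_self_of_unit hq, add_sub_cancel, cross_smul_right, cross_self', smul_zero]
  rw [uPar, cross_add_right, h1]
  simp only [par, cross_smul_right, cross_add_right, cross_self', smul_zero, add_zero]

/-- The parallel thrust exerts no torque. The hat map of a unit vector satisfies `q̂³ = -q̂`, so the
perpendicular thrust cancels the rod acceleration and gravity: the rod acts on a cable loop only
through its reference. -/
theorem IsSolution.ω_deriv_eq (h : IsSolution p K C r s d J) {j : Fin 2} {t : ℝ} (ht : t ∈ J) :
    derivWithin (s.ω j) J t =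
      -cross (s.q j t) (cross (s.q j t) (derivWithin (ωDes p K r s J j) J t))
      + ⟪s.q j t, ωDes p K r s J j t⟫_ℝ • cross (s.q j t) (s.ω j t)
      + cross (s.q j t) (cross (s.q j t) (C.kq j • eqc p K r s j t + C.kω j • eωc p K r s J j t))
      + (p.mQ * p.Lc)⁻¹ • d.q j t := by
  have hI : p.mQ * p.Lc ≠ 0 := (mul_pos p.mQ_pos p.Lc_pos).ne'
  have hq := h.q_unit j t ht
  have h1 := h.ω_dyn j t ht
  have hcube : ∀ w, cross (s.q j t) (cross (s.q j t) (cross (s.q j t) w))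
      = -cross (s.q j t) w := by
    intro w
    rw [cross_cross_self_of_unit hq, real_inner_comm, inner_cross_left_self, zero_smul, zero_sub]
  have hth : cross (s.q j t) (thrust p K C r s J j t)
      = cross (s.q j t) (uPerp p K C r s J j t) := by
    rw [thrust, cross_add_right, cross_uPar hq, zero_add]
  have h2 : (p.mQ * p.Lc) • derivWithin (s.ω j) J t = (p.mQ * p.Lc) •
      (-cross (s.q j t) (cross (s.q j t) (derivWithin (ωDes p K r s J j) J t))
      + ⟪s.q j t, ωDes p K r s J j t⟫_ℝ • cross (s.q j t) (s.ω j t)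
      + cross (s.q j t) (cross (s.q j t) (C.kq j • eqc p K r s j t + C.kω j • eωc p K r s J j t))
      + (p.mQ * p.Lc)⁻¹ • d.q j t) := by
    rw [h1, hth, uPerp, cross_sub_right, cross_neg_right,
      cross_smul_right, hcube]
    simp only [cross_add_right, cross_sub_right, cross_smul_right, smul_add, smul_inv_smul₀ hI]
    module
  exact smul_right_injective E3 hI h2

/-- The cable attitude errors obey an attitude loop. -/
theorem IsSolution.cableLoop (h : IsSolution p K C r s d J) {j : Fin 2} {k B D a b : ℝ}
    (hkq : C.kq j = k ^ 2) (hkω : C.kω j = 2 * k) (hab : Set.Icc a b ⊆ J)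
    (hqd : ∀ t ∈ Set.Icc a b,
      HasDerivWithinAt (qDes p K r s j) (cross (ωDes p K r s J j t) (qDes p K r s j t)) J t ∧
        ‖ωDes p K r s J j t‖ ≤ B)
    (hD : ∀ t ∈ Set.Icc a b, ‖(p.mQ * p.Lc)⁻¹ • d.q j t‖ ≤ D) :
    AttitudeLoop k B D a b (s.q j) (qDes p K r s j) (s.ω j) (ωDes p K r s J j)
      (fun t => (p.mQ * p.Lc)⁻¹ • d.q j t) (derivWithin (s.ω j) J)
      (derivWithin (ωDes p K r s J j) J) (fun _ => 0) where
  q_unit t ht := h.q_unit j t (hab ht)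
  qd_unit t ht := norm_qDes (h.muDes_ne j t (hab ht))
  ω_tangent t ht := h.ω_tangent j t (hab ht)
  q_kin t ht := (h.q_kin j t (hab ht)).mono hab
  qd_kin t ht := (hqd t ht).1.mono hab
  ω_deriv t ht := (h.ω_diff j t (hab ht)).hasDerivWithinAt.mono hab
  ωd_deriv t ht := (h.ωDes_diff j t (hab ht)).hasDerivWithinAt.mono hab
  ωd_le t ht := (hqd t ht).2
  d_le := hD
  σ_le t ht := by
    have := (norm_nonneg _).trans (hqd t ht).2
    simpa using this
  dyn t ht v hv := by
    have hu := h.q_unit j t (hab ht)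
    have hv' : ⟪s.q j t, v⟫_ℝ = 0 := by rw [real_inner_comm]; exact hv
    have e1 : angErr (s.q j t) (s.ω j t) (ωDes p K r s J j t) = eωc p K r s J j t := rfl
    have e2 : cross (qDes p K r s j t) (s.q j t) = eqc p K r s j t := rfl
    rw [h.ω_deriv_eq (hab ht), e1, e2, hkq, hkω, cross_anticomm' (s.q j t) (s.ω j t)]
    simp only [cross_cross_self_of_unit hu, inner_add_left, inner_sub_left, inner_smul_left,
      inner_neg_left, conj_trivial, hv', smul_neg]
    ring

end Loops

/-! ### Bounds for the rod errors and the desired cable forces -/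

section C1Bound

variable {E : Type*} [NormedAddCommGroup E] [NormedSpace ℝ E]

/-- At `t` the curve `f` is differentiable within `J`, and `M` bounds its value and derivative. -/
def C1Bound (M : ℝ) (f : ℝ → E) (J : Set ℝ) (t : ℝ) : Prop :=
  ∃ f', HasDerivWithinAt f f' J t ∧ ‖f t‖ ≤ M ∧ ‖f'‖ ≤ M

variable {M N : ℝ} {f g : ℝ → E} {J : Set ℝ} {t : ℝ}

theorem C1Bound.nonneg (hf : C1Bound M f J t) : 0 ≤ M := by
  obtain ⟨f', _, h, _⟩ := hf
  exact (norm_nonneg _).trans h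

theorem C1Bound.mono (hf : C1Bound M f J t) (h : M ≤ N) : C1Bound N f J t := by
  obtain ⟨f', h1, h2, h3⟩ := hf
  exact ⟨f', h1, h2.trans h, h3.trans h⟩

theorem C1Bound.const (c : E) : C1Bound ‖c‖ (fun _ => c) J t :=
  ⟨0, hasDerivWithinAt_const t J c, le_rfl, by simp⟩

theorem C1Bound.add (hf : C1Bound M f J t) (hg : C1Bound N g J t) :
    C1Bound (M + N) (fun t => f t + g t) J t := by
  obtain ⟨f', h1, h2, h3⟩ := hf
  obtain ⟨g', k1, k2, k3⟩ := hg
  exact ⟨_, h1.add k1, (norm_add_le _ _).trans (add_le_add h2 k2),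
    (norm_add_le _ _).trans (add_le_add h3 k3)⟩

theorem C1Bound.neg (hf : C1Bound M f J t) : C1Bound M (fun t => -f t) J t := by
  obtain ⟨f', h1, h2, h3⟩ := hf
  exact ⟨_, h1.neg, by rwa [norm_neg], by rwa [norm_neg]⟩

theorem C1Bound.sub (hf : C1Bound M f J t) (hg : C1Bound N g J t) :
    C1Bound (M + N) (fun t => f t - g t) J t := by
  simpa only [sub_eq_add_neg] using hf.add hg.neg

theorem C1Bound.const_smul (hf : C1Bound M f J t) (c : ℝ) :
    C1Bound (‖c‖ * M) (fun t => c • f t) J t := by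
  obtain ⟨f', h1, h2, h3⟩ := hf
  refine ⟨_, h1.const_smul c, ?_, ?_⟩ <;> rw [norm_smul] <;> gcongr

theorem C1Bound.smul {c : ℝ → ℝ} (hc : C1Bound M c J t) (hf : C1Bound N f J t) :
    C1Bound (2 * (M * N)) (fun t => c t • f t) J t := by
  have hM := hc.nonneg
  have hN := hf.nonneg
  obtain ⟨c', h1, h2, h3⟩ := hc
  obtain ⟨f', k1, k2, k3⟩ := hf
  refine ⟨_, h1.smul k1, ?_, ?_⟩
  · rw [norm_smul]
    have : ‖c t‖ * ‖f t‖ ≤ M * N := by gcongr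
    have : 0 ≤ M * N := by positivity
    linarith
  · refine (norm_add_le _ _).trans ?_
    rw [norm_smul, norm_smul]
    have : ‖c t‖ * ‖f'‖ ≤ M * N := by gcongr
    have : ‖c'‖ * ‖f t‖ ≤ M * N := by gcongr
    linarith

theorem C1Bound.inner {f g : ℝ → E3} (hf : C1Bound M f J t) (hg : C1Bound N g J t) :
    C1Bound (2 * (M * N)) (fun t => ⟪f t, g t⟫_ℝ) J t := by
  have hM := hf.nonneg
  have hN := hg.nonneg
  obtain ⟨f', h1, h2, h3⟩ := hf
  obtain ⟨g', k1, k2, k3⟩ := hg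
  have hb : ∀ {a b : E3}, ‖a‖ ≤ M → ‖b‖ ≤ N → ‖⟪a, b⟫_ℝ‖ ≤ M * N := fun ha hb =>
    (norm_inner_le_norm _ _).trans (by gcongr)
  have h0 : 0 ≤ M * N := by positivity
  refine ⟨_, h1.inner ℝ k1, ?_, (norm_add_le _ _).trans ?_⟩
  · linarith [hb h2 k2]
  · linarith [hb h2 k3, hb h3 k2]

theorem C1Bound.cross {f g : ℝ → E3} (hf : C1Bound M f J t) (hg : C1Bound N g J t) :
    C1Bound (2 * (M * N)) (fun t => cross (f t) (g t)) J t := by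
  have hM := hf.nonneg
  have hN := hg.nonneg
  obtain ⟨f', h1, h2, h3⟩ := hf
  obtain ⟨g', k1, k2, k3⟩ := hg
  have hb : ∀ {a b : E3}, ‖a‖ ≤ M → ‖b‖ ≤ N → ‖RodTransport.cross a b‖ ≤ M * N := fun ha hb =>
    (norm_cross_le _ _).trans (by gcongr)
  have h0 : 0 ≤ M * N := by positivity
  refine ⟨_, hasDerivWithinAt_cross h1 k1, ?_, (norm_add_le _ _).trans ?_⟩
  · linarith [hb h2 k2]
  · linarith [hb h2 k3, hb h3 k2]

end C1Bound

theorem norm_smul_le_of_le {x M : ℝ} {w : E3} (hw : ‖w‖ ≤ M) : ‖x • w‖ ≤ |x| * M := by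
  rw [norm_smul, Real.norm_eq_abs]; gcongr

theorem norm_cross_le_of_unit {q w : E3} {M : ℝ} (hq : ‖q‖ = 1) (hw : ‖w‖ ≤ M) :
    ‖cross q w‖ ≤ M := by
  simpa [hq] using (norm_cross_le q w).trans (by rw [hq, one_mul]; exact hw)

/-- The desired cable forces are bounded while the rod errors are. -/
theorem exists_bound_muDes (p : Params) (K : RodGains) (r : Reference) (B R : ℝ) :
    ∃ M : ℝ, ∀ (s : Motion) (t : ℝ), ‖s.qr t‖ = 1 → ‖deriv (velDes r.xd) t‖ ≤ B →
      ‖angVel r.qd t‖ ≤ B → ‖deriv (angVel r.qd) t‖ ≤ B →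
      ‖ex r s t‖ ≤ R → ‖ev r s t‖ ≤ R → ‖eωr r s t‖ ≤ R → ∀ j, ‖muDes p K r s j t‖ ≤ M := by
  apply Exists.intro
  intro s t hq hB1 hB2 hB3 hx hv hω j
  have hB : 0 ≤ B := (norm_nonneg _).trans hB1
  have hi : ∀ w : E3, ‖w‖ ≤ R ∨ ‖w‖ ≤ B →
      ‖⟪s.qr t, angVel r.qd t⟫_ℝ • w‖ ≤ B * max R B := fun w hw => by
    rw [norm_smul]
    refine mul_le_mul ?_ (le_max_iff.2 hw) (norm_nonneg _) hB
    refine (norm_inner_le_norm _ _).trans ?_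
    rwa [hq, one_mul]
  have hsum : ‖muSum p K r s t‖ ≤ |p.mr| * (B + |p.g| * ‖e3‖ + |K.kv| * R + |K.kx| * R) :=
    norm_smul_le_of_le <| norm_sub_le_of_le (norm_sub_le_of_le (norm_add_le_of_le hB1
      (norm_smul_le_of_le le_rfl)) (norm_smul_le_of_le hv)) (norm_smul_le_of_le hx)
  have heq : ‖eqr r s t‖ ≤ 1 := norm_cross_le_of_unit (r.qd_unit t) hq.le
  have hdiff : ‖muDiff p K r s t‖ ≤ |2 / 3 * p.mr * p.Lr| *
      (B + B * max R B + B * max R B + |K.kω| * R + |K.kq| * 1) :=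
    norm_smul_le_of_le <| norm_add_le_of_le (norm_add_le_of_le (norm_sub_le_of_le
      (norm_add_le_of_le (by rw [norm_neg]; exact norm_cross_le_of_unit hq hB3)
        (hi _ (Or.inr (norm_cross_le_of_unit hq (norm_cross_le_of_unit hq hB2)))))
      (hi _ (Or.inl hω))) (norm_smul_le_of_le (norm_cross_le_of_unit hq hω)))
      (norm_smul_le_of_le (norm_cross_le_of_unit hq heq))
  have hsgn : |sgn j| = 1 := by fin_cases j <;> simp [sgn_zero, sgn_one]
  have hsd := norm_smul_le_of_le (x := sgn j) hdiff
  rw [hsgn] at hsd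
  exact norm_smul_le_of_le (norm_add_le_of_le hsum hsd)

/-- While the rod errors are bounded, so are the rates of change of the rod errors and of the
desired cable forces, uniformly over all cable gains. -/
theorem exists_C1Bound (p : Params) (K : RodGains) (r : Reference) (δ : DistBound) (R : ℝ) :
    ∃ M : ℝ, ∀ (C : CableGains) (s : Motion) (d : Disturbance) (J : Set ℝ),
      IsSolution p K C r s d J → d.BoundedBy δ J → ∀ t ∈ J, 0 ≤ t →
      ‖ex r s t‖ ≤ R → ‖ev r s t‖ ≤ R → ‖eωr r s t‖ ≤ R →
      C1Bound M (ex r s) J t ∧ C1Bound M (ev r s) J t ∧ C1Bound M (eωr r s) J t ∧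
      C1Bound M (Ψr r s) J t ∧ ∀ j, C1Bound M (muDes p K r s j) J t := by
  obtain ⟨B, hB⟩ := r.bounded
  obtain ⟨M₀, hM₀⟩ := exists_bound_muDes p K r B R
  have hm := p.mr_pos
  have hI : 0 < 2 / 3 * p.mr * p.Lr := by have := p.Lr_pos; positivity
  suffices h : ∃ M₁ M₂ M₃ M₄ M₅ : ℝ, ∀ (C : CableGains) (s : Motion) (d : Disturbance) (J : Set ℝ),
      IsSolution p K C r s d J → d.BoundedBy δ J → ∀ t ∈ J, 0 ≤ t →
      ‖ex r s t‖ ≤ R → ‖ev r s t‖ ≤ R → ‖eωr r s t‖ ≤ R →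
      C1Bound M₁ (ex r s) J t ∧ C1Bound M₂ (ev r s) J t ∧ C1Bound M₃ (eωr r s) J t ∧
      C1Bound M₄ (Ψr r s) J t ∧ ∀ j, C1Bound M₅ (muDes p K r s j) J t by
    obtain ⟨M₁, M₂, M₃, M₄, M₅, h⟩ := h
    refine ⟨|M₁| + |M₂| + |M₃| + |M₄| + |M₅|, fun C s d J hs hd t ht ht0 hx hv hω => ?_⟩
    obtain ⟨h1, h2, h3, h4, h5⟩ := h C s d J hs hd t ht ht0 hx hv hω
    have a1 := abs_nonneg M₁
    have a2 := abs_nonneg M₂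
    have a3 := abs_nonneg M₃
    have a4 := abs_nonneg M₄
    have a5 := abs_nonneg M₅
    refine ⟨h1.mono ?_, h2.mono ?_, h3.mono ?_, h4.mono ?_, fun j => (h5 j).mono ?_⟩
    · linarith [le_abs_self M₁]
    · linarith [le_abs_self M₂]
    · linarith [le_abs_self M₃]
    · linarith [le_abs_self M₄]
    · linarith [le_abs_self M₅]
  -- The five bounds are read off from the estimates below.
  iterate 5 apply Exists.intro
  intro C s d J hs hd t ht ht0 hx hv hω
  obtain ⟨hB1, hB2, hB3, hB4, hB5⟩ := hB t ht0
  obtain ⟨hd1, hd2, -⟩ := hd t ht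
  have hq := hs.qr_unit t ht
  have hμ := hM₀ s t hq hB1 hB3 hB4 hx hv hω
  -- The rod accelerations are determined by these applied forces and the disturbances. The thrusts,
  -- and with them the cable gains, do not enter.
  have hmu : ∀ j, ‖mu p K r s j t‖ ≤ M₀ + M₀ := fun j =>
    norm_add_le_of_le (hμ j)
      (norm_cross_le_of_unit (hs.q_unit j t ht) (norm_cross_le_of_unit (hs.q_unit j t ht) (hμ j)))
  have hacc : ‖derivWithin s.v J t‖
      ≤ |p.mr⁻¹| * (M₀ + M₀ + (M₀ + M₀) + δ.x) + |p.g| * ‖e3‖ := by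
    have h1 : derivWithin s.v J t
        = p.mr⁻¹ • (mu p K r s 0 t + mu p K r s 1 t + d.x t) - p.g • e3 := by
      rw [← hs.v_dyn t ht, inv_smul_smul₀ hm.ne', add_sub_cancel_right]
    rw [h1]
    exact norm_sub_le_of_le (norm_smul_le_of_le (norm_add_le_of_le (norm_add_le_of_le (hmu 0)
      (hmu 1)) hd1)) (norm_smul_le_of_le le_rfl)
  have hωacc : ‖derivWithin s.ωr J t‖
      ≤ |(2 / 3 * p.mr * p.Lr)⁻¹| * (M₀ + M₀ + (M₀ + M₀) + δ.qr) := by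
    have h1 : derivWithin s.ωr J t = (2 / 3 * p.mr * p.Lr)⁻¹ •
        (cross (s.qr t) (mu p K r s 1 t - mu p K r s 0 t) + d.qr t) := by
      rw [← hs.ωr_dyn t ht, inv_smul_smul₀ hI.ne']
    rw [h1]
    exact norm_smul_le_of_le (norm_add_le_of_le (norm_cross_le_of_unit hq
      (norm_sub_le_of_le (hmu 1) (hmu 0))) hd2)
  have hωr : ‖s.ωr t‖ ≤ R + B := by
    have h1 : s.ωr t = eωr r s t - cross (s.qr t) (cross (s.qr t) (angVel r.qd t)) := by
      rw [eωr]; abel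
    rw [h1]
    exact norm_sub_le_of_le hω (norm_cross_le_of_unit hq (norm_cross_le_of_unit hq hB3))
  have cx : C1Bound R (ex r s) J t := ⟨_, hs.hasDerivWithinAt_ex ht, hx, hv⟩
  have cv : C1Bound (max R (|p.mr⁻¹| * (M₀ + M₀ + (M₀ + M₀) + δ.x) + |p.g| * ‖e3‖ + B))
      (ev r s) J t := ⟨_, hs.hasDerivWithinAt_ev ht, hv.trans (le_max_left _ _),
        (norm_sub_le_of_le hacc hB1).trans (le_max_right _ _)⟩
  have cω : C1Bound (max (R + B) (|(2 / 3 * p.mr * p.Lr)⁻¹| * (M₀ + M₀ + (M₀ + M₀) + δ.qr)))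
      s.ωr J t := ⟨_, (hs.ωr_diff t ht).hasDerivWithinAt, hωr.trans (le_max_left _ _),
        hωacc.trans (le_max_right _ _)⟩
  have cq : C1Bound (max 1 (R + B)) s.qr J t := ⟨_, hs.qr_kin t ht, hq.le.trans (le_max_left _ _),
    (by simpa [hq] using (norm_cross_le (s.ωr t) (s.qr t)).trans (by rw [hq, mul_one]) :
      ‖cross (s.ωr t) (s.qr t)‖ ≤ ‖s.ωr t‖).trans (hωr.trans (le_max_right _ _))⟩
  have cqd : C1Bound (max 1 B) r.qd J t := ⟨_, (r.hasDerivAt_qd t).hasDerivWithinAt,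
    (r.qd_unit t).le.trans (le_max_left _ _),
    ((norm_cross_le _ _).trans (by rw [r.qd_unit t, mul_one])).trans
      (hB3.trans (le_max_right _ _))⟩
  have cωd : C1Bound B (angVel r.qd) J t := ⟨_, (r.hasDerivAt_angVel t).hasDerivWithinAt, hB3, hB4⟩
  have cωd' : C1Bound B (deriv (angVel r.qd)) J t :=
    ⟨_, (r.hasDerivAt_deriv_angVel t).hasDerivWithinAt, hB4, hB5⟩
  have cvd' : C1Bound B (deriv (velDes r.xd)) J t :=
    ⟨_, (r.hasDerivAt_deriv_velDes t).hasDerivWithinAt, hB1, hB2⟩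
  have cqqω := cq.cross (cq.cross cωd)
  have ceω : C1Bound _ (eωr r s) J t := cω.add cqqω
  have csum : C1Bound _ (muSum p K r s) J t :=
    (((cvd'.add (C1Bound.const (p.g • e3))).sub (cv.const_smul K.kv)).sub
      (cx.const_smul K.kx)).const_smul p.mr
  have ci := cq.inner cωd
  have ceq : C1Bound _ (eqr r s) J t := cqd.cross cq
  have cdiff : C1Bound _ (muDiff p K r s) J t :=
    (((((cq.cross cωd').neg.add (ci.smul cqqω)).sub (ci.smul ceω)).add
      ((cq.cross ceω).const_smul K.kω)).add
      ((cq.cross ceq).const_smul K.kq)).const_smul (2 / 3 * p.mr * p.Lr)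
  refine ⟨cx, cv, ceω, (C1Bound.const (1 : ℝ)).sub (cqd.inner cq), fun j => ?_⟩
  have hsgn : ‖sgn j‖ = 1 := by fin_cases j <;> simp [sgn_zero, sgn_one]
  have c := (csum.add (cdiff.const_smul (sgn j))).const_smul (1 / 2 : ℝ)
  rw [hsgn] at c
  exact c

/-! ### Choice of the gains -/

/-- Rod gains for which the rod errors decay to any prescribed size as long as the cable forces
deviate from the desired ones by at most `1`. -/
theorem exists_rodGain (p : Params) (r : Reference) (δ : DistBound) (D : DomainBound) {η : ℝ}
    (hη : 0 < η) :
    ∃ k κx κq : ℝ, 1 ≤ k ∧ 0 < κx ∧ 0 < κq ∧ κx / k ^ 2 ≤ η ∧ κq / k ^ 2 ≤ η ∧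
      ∀ (K : RodGains), K.kx = k ^ 2 → K.kv = 2 * k → K.kq = k ^ 2 → K.kω = 2 * k →
      ∀ (C : CableGains) (s : Motion) (d : Disturbance) (J : Set ℝ) (a b : ℝ),
        IsSolution p K C r s d J → d.BoundedBy δ J → 0 ≤ a → Set.Icc a b ⊆ J →
        (∀ j, ∀ t ∈ Set.Icc a b, ‖muErr p K r s j t‖ ≤ 1) →
        ‖ex r s a‖ ≤ D.ex + 1 → ‖ev r s a‖ ≤ D.ev + 1 → ‖eωr r s a‖ ≤ D.eωr + 1 →
        Ψr r s a ≤ (1 + D.ψr) / 2 →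
        ∀ t ∈ Set.Icc a b,
          k ^ 2 * ‖ex r s t‖ ^ 2 + ‖ev r s t‖ ^ 2 ≤ envelope κx k (t - a) ∧
          k ^ 2 * ‖eqr r s t‖ ^ 2 + ‖eωr r s t‖ ^ 2 ≤ envelope κq k (t - a) := by
  obtain ⟨B, hB⟩ := r.bounded
  -- The initial bounds are enlarged, with `(1 + D.ψr) / 2` still below 1, to leave room for the
  -- drift while the cables align. Each of the two force errors contributes 1 to the disturbance.
  obtain ⟨κx, hκx, hx⟩ := exists_gain_positionLoop (D.ex + 1) (D.ev + 1)
    (|p.mr⁻¹| * (1 + 1 + δ.x))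
  obtain ⟨k₀, κq, hk₀, hκq, hq⟩ := exists_gain_attitudeLoop (ψ := (1 + D.ψr) / 2)
    (by linarith [D.ψr_pos]) (by linarith [D.ψr_lt]) (D.eωr + 1) B
    (|(2 / 3 * p.mr * p.Lr)⁻¹| * (1 + 1 + δ.qr) + 2 * B * B)
  obtain ⟨k, hk, hkx, hkq⟩ := ((Filter.eventually_ge_atTop k₀).and
    ((eventually_div_sq_le (κ := κx) hη).and (eventually_div_sq_le (κ := κq) hη))).exists
  refine ⟨k, κx, κq, hk₀.trans hk, hκx, hκq, hkx, hkq, ?_⟩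
  intro K hKx hKv hKq hKω C s d J a b hs hd ha hab hμ hxa hva hωa hΨa t ht
  constructor
  · refine hx k (hk₀.trans hk) a b (ex r s) (ev r s)
      (fun t => p.mr⁻¹ • (muErr p K r s 0 t + muErr p K r s 1 t + d.x t))
      (fun t ht => (hs.hasDerivWithinAt_ex (hab ht)).mono hab) (fun t ht => ?_) (fun t ht => ?_)
      hxa hva t ht
    · have h1 := (hs.hasDerivWithinAt_ev (hab ht)).mono hab
      rwa [hs.acc_error_eq (hab ht), hKv, hKx] at h1
    · exact norm_smul_le_of_le (norm_add_le_of_le (norm_add_le_of_le (hμ 0 t ht) (hμ 1 t ht))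
        (hd t (hab ht)).1)
  · have hB' : ∀ t ∈ Set.Icc a b, ‖angVel r.qd t‖ ≤ B := fun t ht => (hB t (ha.trans ht.1)).2.2.1
    refine hq k hk a b _ _ _ _ _ _ _ _ (hs.rodLoop hKq hKω hab hB' (fun t ht => ?_)) hωa hΨa t ht
    have hu := hs.qr_unit t (hab ht)
    have hB0 : 0 ≤ B := (norm_nonneg _).trans (hB' t ht)
    refine norm_add_le_of_le (norm_smul_le_of_le (norm_add_le_of_le
      (norm_cross_le_of_unit hu (norm_sub_le_of_le (hμ 1 t ht) (hμ 0 t ht))) (hd t (hab ht)).2.1)) ?_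
    rw [norm_smul, norm_mul, Real.norm_two]
    refine mul_le_mul (mul_le_mul_of_nonneg_left ?_ zero_le_two) ?_ (norm_nonneg _) (by positivity)
    · refine (norm_inner_le_norm _ _).trans ?_
      rw [hu, one_mul]
      exact hB' t ht
    · refine (norm_cross_le _ _).trans ?_
      rw [hu, mul_one]
      exact hB' t ht

/-- Cable gains for which the cable attitude error is small from the time `τ` on, and the cable
errors decay to any prescribed size. -/
theorem exists_cableGain (p : Params) (δ : DistBound) (j : Fin 2) {ψ η τ ε : ℝ} (Y₀ B : ℝ)
    (hψ : 0 < ψ) (hψ1 : ψ < 1) (hη : 0 < η) (hτ : 0 < τ) (hε : 0 < ε) :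
    ∃ k κ : ℝ, 1 ≤ k ∧ 0 < κ ∧ κ / k ^ 2 ≤ η ∧
      ∀ (C : CableGains), C.kq j = k ^ 2 → C.kω j = 2 * k →
      ∀ (K : RodGains) (r : Reference) (s : Motion) (d : Disturbance) (J : Set ℝ) (a b : ℝ),
        IsSolution p K C r s d J → d.BoundedBy δ J → Set.Icc a b ⊆ J →
        (∀ t ∈ Set.Icc a b,
          HasDerivWithinAt (qDes p K r s j) (cross (ωDes p K r s J j t) (qDes p K r s j t)) J t ∧
            ‖ωDes p K r s J j t‖ ≤ B) →
        ‖eωc p K r s J j a‖ ≤ Y₀ → Ψ p K r s j a ≤ ψ →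
        ∀ t ∈ Set.Icc a b,
          k ^ 2 * ‖eqc p K r s j t‖ ^ 2 + ‖eωc p K r s J j t‖ ^ 2 ≤ envelope κ k (t - a) ∧
          (a + τ ≤ t → ‖eqc p K r s j t‖ ^ 2 ≤ ε) := by
  obtain ⟨k₀, κ, hk₀, hκ, hq⟩ := exists_gain_attitudeLoop hψ hψ1 Y₀ B
    (|(p.mQ * p.Lc)⁻¹| * δ.q j)
  obtain ⟨k, hk, hkη, hkε⟩ := ((Filter.eventually_ge_atTop k₀).and
    ((eventually_div_sq_le (κ := κ) hη).and (eventually_envelope_le hκ hτ hε))).exists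
  have hk1 := hk₀.trans hk
  refine ⟨k, κ, hk1, hκ, hkη, ?_⟩
  intro C hCq hCω K r s d J a b hs hd hab hqd hωa hΨa t ht
  have h1 := hq k hk a b _ _ _ _ _ _ _ _ (hs.cableLoop hCq hCω hab hqd
    (fun t ht => norm_smul_le_of_le ((hd t (hab ht)).2.2 j))) hωa hΨa t ht
  refine ⟨h1, fun hτt => ?_⟩
  have h2 := h1.trans (hkε (t - a) (by linarith))
  have h3 : k ^ 2 * ‖eqc p K r s j t‖ ^ 2 ≤ k ^ 2 * ε :=
    le_trans (le_add_of_nonneg_right (sq_nonneg _)) h2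
  exact le_of_mul_le_mul_left h3 (by positivity)

/-! ### The closed loop -/

theorem norm_sub_le_of_C1Bound {E : Type*} [NormedAddCommGroup E] [NormedSpace ℝ E] {M a b : ℝ}
    {f : ℝ → E} {J : Set ℝ} (hab : a ≤ b) (hJ : Set.Icc a b ⊆ J)
    (h : ∀ t ∈ Set.Icc a b, C1Bound M f J t) : ‖f b - f a‖ ≤ M * (b - a) := by
  have h' : ∀ t, ∃ f', t ∈ Set.Icc a b → HasDerivWithinAt f f' J t ∧ ‖f'‖ ≤ M := fun t => by
    by_cases ht : t ∈ Set.Icc a b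
    · obtain ⟨f', h1, -, h2⟩ := h t ht
      exact ⟨f', fun _ => ⟨h1, h2⟩⟩
    · exact ⟨0, fun h => absurd h ht⟩
  choose f' hf' using h'
  exact norm_image_sub_le_of_norm_deriv_le_segment' (fun t ht => (hf' t ht).1.mono hJ)
    (fun t ht => (hf' t (Set.Ico_subset_Icc_self ht)).2) b ⟨hab, le_rfl⟩

/-- The squared norm of the rod errors other than the attitude error. -/
def rodSize (r : Reference) (s : Motion) (t : ℝ) : ℝ :=
  ‖ex r s t‖ ^ 2 + ‖ev r s t‖ ^ 2 + ‖eωr r s t‖ ^ 2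

theorem norm_le_of_rodSize_le {r : Reference} {s : Motion} {t R : ℝ} (hR : 1 ≤ R)
    (h : rodSize r s t ≤ R) : ‖ex r s t‖ ≤ R ∧ ‖ev r s t‖ ≤ R ∧ ‖eωr r s t‖ ≤ R := by
  unfold rodSize at h
  have h1 := sq_nonneg ‖ex r s t‖
  have h2 := sq_nonneg ‖ev r s t‖
  have h3 := sq_nonneg ‖eωr r s t‖
  refine ⟨?_, ?_, ?_⟩ <;> nlinarith

theorem IsSolution.continuousOn_rodSize {p : Params} {K : RodGains} {C : CableGains}
    {r : Reference} {s : Motion} {d : Disturbance} {J : Set ℝ} (h : IsSolution p K C r s d J) :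
    ContinuousOn (rodSize r s) J := by
  intro t ht
  have h1 := (h.hasDerivWithinAt_ex ht).continuousWithinAt
  have h2 := (h.hasDerivWithinAt_ev ht).continuousWithinAt
  have h3 : ContinuousWithinAt (eωr r s) J t :=
    ((h.ωr_diff t ht).hasDerivWithinAt.add (hasDerivWithinAt_cross (h.qr_kin t ht)
      (hasDerivWithinAt_cross (h.qr_kin t ht)
        (r.hasDerivAt_angVel t).hasDerivWithinAt))).continuousWithinAt
  exact ((h1.norm.pow 2).add (h2.norm.pow 2)).add (h3.norm.pow 2)

/-- The squared error norm consists of four pairs, each at most `b ^ 2 / 4`. -/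
theorem errNorm_le {p : Params} {K : RodGains} {r : Reference} {s : Motion} {J : Set ℝ}
    {t b k : ℝ} {kc : Fin 2 → ℝ} (hb : 0 < b) (hk : 1 ≤ k) (hkc : ∀ j, 1 ≤ kc j)
    (h1 : k ^ 2 * ‖ex r s t‖ ^ 2 + ‖ev r s t‖ ^ 2 ≤ 2 * (b ^ 2 / 8))
    (h2 : k ^ 2 * ‖eqr r s t‖ ^ 2 + ‖eωr r s t‖ ^ 2 ≤ 2 * (b ^ 2 / 8))
    (h3 : ∀ j, kc j ^ 2 * ‖eqc p K r s j t‖ ^ 2 + ‖eωc p K r s J j t‖ ^ 2 ≤ 2 * (b ^ 2 / 8)) :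
    errNorm p K r s J t ≤ b := by
  have hone : ∀ {k x : ℝ}, 1 ≤ k → x ^ 2 ≤ k ^ 2 * x ^ 2 := fun hk =>
    le_mul_of_one_le_left (sq_nonneg _) (one_le_pow₀ hk)
  refine Real.sqrt_le_iff.2 ⟨hb.le, ?_⟩
  rw [Fin.sum_univ_two]
  linarith [hone (x := ‖ex r s t‖) hk, hone (x := ‖eqr r s t‖) hk,
    hone (x := ‖eqc p K r s 0 t‖) (hkc 0), hone (x := ‖eqc p K r s 1 t‖) (hkc 1), h3 0, h3 1]

/-- Practical stability with high gains: the cable loops are so fast that the rod hardly moves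
while the cables align with the desired cable forces. Hence no smallness of the cable attitude
errors beyond `ψ j < 1` is needed. -/
theorem exists_gains_uniformlyUltimatelyBounded (p : Params) (r : Reference) (δ : DistBound)
    (D : DomainBound) (ψ : Fin 2 → ℝ) (hψ : ∀ j, 0 < ψ j ∧ ψ j < 1) (b : ℝ) (hb : 0 < b) :
    ∃ K : RodGains, ∀ m₀ : ℝ, 0 < m₀ → ∃ C : CableGains,
      UniformlyUltimatelyBounded p K C r δ D ψ m₀ b := by
  have hη : 0 < b ^ 2 / 8 := by positivity
  obtain ⟨k, κx, κq, hk, hκx, hκq, hkx, hkq, hrod⟩ := exists_rodGain p r δ D hη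
  have hk0 : 0 < k := by linarith
  refine ⟨⟨k ^ 2, 2 * k, k ^ 2, 2 * k, by positivity, by positivity, by positivity,
    by positivity⟩, ?_⟩
  intro m₀ hm₀
  generalize hK : (⟨k ^ 2, 2 * k, k ^ 2, 2 * k, by positivity, by positivity, by positivity,
    by positivity⟩ : RodGains) = K
  -- The ball has to contain the enlarged initial errors and the largest values of both rod
  -- envelopes; the final 1 makes the containment strict.
  obtain ⟨R, hR⟩ : ∃ R, R = (κx * k ^ 2 + κx) + (κq * k ^ 2 + κq)
    + ((D.ex + 1) ^ 2 + (D.ev + 1) ^ 2 + (D.eωr + 1) ^ 2) + 1 := ⟨_, rfl⟩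
  have hRx : 0 ≤ κx * k ^ 2 + κx := by positivity
  have hRq : 0 ≤ κq * k ^ 2 + κq := by positivity
  have hRD : 0 ≤ (D.ex + 1) ^ 2 + (D.ev + 1) ^ 2 + (D.eωr + 1) ^ 2 := by positivity
  have hR1 : 1 ≤ R := by linarith
  obtain ⟨M, hM⟩ := exists_C1Bound p K r δ R
  have hM0 : 0 ≤ |M| := abs_nonneg M
  -- A quantity with rate at most `M` moves by at most `(1 - D.ψr) / 2 < 1` in time `τ`, which
  -- respects all margins of `exists_rodGain`.
  obtain ⟨τ, hτdef⟩ : ∃ τ, τ = (1 - D.ψr) / 2 / (|M| + 1) := ⟨_, rfl⟩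
  have hψr : 0 < (1 - D.ψr) / 2 := by linarith [D.ψr_lt]
  have hτ : 0 < τ := by rw [hτdef]; positivity
  have hMτ : M * τ ≤ (1 - D.ψr) / 2 := by
    have : (|M| + 1) * τ = (1 - D.ψr) / 2 := by rw [hτdef]; field_simp
    nlinarith [le_abs_self M]
  -- A cable attitude error of at most `(|M| + 1)⁻¹` times a desired force of at most `M` gives a
  -- force error of at most 1.
  have hε : 0 < ((|M| + 1)⁻¹) ^ 2 := by positivity
  have hcab := fun j => exists_cableGain p δ j (D.eω j) (2 * M / m₀) (hψ j).1 (hψ j).2 hη hτ hε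
  choose kc κc hkc hκc hkcη hcable using hcab
  refine ⟨⟨fun j => kc j ^ 2, fun j => 2 * kc j, fun j => ?_, fun j => ?_⟩, ?_⟩
  · have := hkc j; positivity
  · have := hkc j; positivity
  generalize hC : (⟨fun j => kc j ^ 2, fun j => 2 * kc j, _, _⟩ : CableGains) = C
  obtain ⟨Tx, hTx0, hTx⟩ := exists_time_envelope_le hκx hk hη hkx
  obtain ⟨Tq, hTq0, hTq⟩ := exists_time_envelope_le hκq hk hη hkq
  have hTc := fun j => exists_time_envelope_le (hκc j) (hkc j) hη (hkcη j)
  choose Tc hTc0 hTc using hTc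
  have hTc0' := hTc0 0
  have hTc1' := hTc0 1
  refine ⟨τ + Tx + Tq + Tc 0 + Tc 1, by positivity, ?_⟩
  intro t₀ t₁ s d ht₀ hs hd hm hdom t ht
  -- Since `τ > 0`, the interval is nondegenerate, so derivatives within it are unique.
  have ht01 : t₀ < t₁ := by linarith [ht.1, ht.2]
  obtain ⟨hdx, hdv, hdω, hdΨ, hdc⟩ := hdom
  -- Consequences of staying in the ball up to time `u`: decay of the cable errors, small drift of
  -- the rod up to `t₀ + τ`, and small force errors from then on.
  have step : ∀ u ∈ Set.Icc t₀ t₁, (∀ v ∈ Set.Icc t₀ u, rodSize r s v ≤ R) →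
      (∀ j, kc j ^ 2 * ‖eqc p K r s j u‖ ^ 2 + ‖eωc p K r s (Set.Icc t₀ t₁) j u‖ ^ 2
        ≤ envelope (κc j) (kc j) (u - t₀)) ∧
      (u ≤ t₀ + τ → ‖ex r s u‖ ≤ D.ex + 1 ∧ ‖ev r s u‖ ≤ D.ev + 1 ∧ ‖eωr r s u‖ ≤ D.eωr + 1 ∧
        Ψr r s u ≤ (1 + D.ψr) / 2) ∧
      (∀ v ∈ Set.Icc t₀ u, t₀ + τ ≤ v → ∀ j, ‖muErr p K r s j v‖ ≤ 1) := by
    intro u hu hbox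
    have hsub : Set.Icc t₀ u ⊆ Set.Icc t₀ t₁ := Set.Icc_subset_Icc_right hu.2
    have hC1 := fun v (hv : v ∈ Set.Icc t₀ u) =>
      hM C s d _ hs hd v (hsub hv) (ht₀.trans hv.1) (norm_le_of_rodSize_le hR1 (hbox v hv)).1
        (norm_le_of_rodSize_le hR1 (hbox v hv)).2.1 (norm_le_of_rodSize_le hR1 (hbox v hv)).2.2
    have hc := fun j => hcable j C (by rw [← hC]) (by rw [← hC]) K r s d _ t₀ u hs hd hsub
      (fun v hv => by
        obtain ⟨μ', hμ', -, hμM⟩ := (hC1 v hv).2.2.2.2 j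
        exact hs.qDes_kin (hsub hv) (uniqueDiffOn_Icc ht01 v (hsub hv)) hm₀ hμ' hμM
          (hm j v (hsub hv)))
      (hdc j).1 (hdc j).2
    refine ⟨fun j => (hc j u ⟨hu.1, le_rfl⟩).1, fun huτ => ?_, fun v hv hvτ j => ?_⟩
    · have hM0' : 0 ≤ M := (hC1 u ⟨hu.1, le_rfl⟩).1.nonneg
      have hMu : M * (u - t₀) ≤ (1 - D.ψr) / 2 :=
        (mul_le_mul_of_nonneg_left (by linarith) hM0').trans hMτ
      have hMu1 : M * (u - t₀) ≤ 1 := by linarith [D.ψr_pos]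
      have e1 := norm_sub_le_of_C1Bound hu.1 hsub (fun v hv => (hC1 v hv).1)
      have e2 := norm_sub_le_of_C1Bound hu.1 hsub (fun v hv => (hC1 v hv).2.1)
      have e3 := norm_sub_le_of_C1Bound hu.1 hsub (fun v hv => (hC1 v hv).2.2.1)
      have e4 := norm_sub_le_of_C1Bound hu.1 hsub (fun v hv => (hC1 v hv).2.2.2.1)
      rw [Real.norm_eq_abs] at e4
      refine ⟨?_, ?_, ?_, ?_⟩
      · linarith [norm_sub_norm_le (ex r s u) (ex r s t₀)]
      · linarith [norm_sub_norm_le (ev r s u) (ev r s t₀)]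
      · linarith [norm_sub_norm_le (eωr r s u) (eωr r s t₀)]
      · linarith [le_abs_self (Ψr r s u - Ψr r s t₀)]
    · have e1 : ‖eqc p K r s j v‖ ≤ (|M| + 1)⁻¹ :=
        (sq_le_sq₀ (norm_nonneg _) (by positivity)).1 ((hc j v hv).2 hvτ)
      obtain ⟨-, -, e2, -⟩ := (hC1 v hv).2.2.2.2 j
      refine (norm_muErr_le (hs.q_unit j v (hsub hv)) (hs.muDes_ne j v (hsub hv))).trans ?_
      calc ‖muDes p K r s j v‖ * ‖eqc p K r s j v‖ ≤ (|M| + 1) * (|M| + 1)⁻¹ := by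
            gcongr
            linarith [le_abs_self M]
        _ = 1 := mul_inv_cancel₀ (by positivity)
  -- The rod loops are restarted at `t₀ + τ`, from the slightly enlarged initial set.
  have late : ∀ u ∈ Set.Icc t₀ t₁, (∀ v ∈ Set.Icc t₀ u, rodSize r s v ≤ R) → t₀ + τ ≤ u →
      k ^ 2 * ‖ex r s u‖ ^ 2 + ‖ev r s u‖ ^ 2 ≤ envelope κx k (u - (t₀ + τ)) ∧
      k ^ 2 * ‖eqr r s u‖ ^ 2 + ‖eωr r s u‖ ^ 2 ≤ envelope κq k (u - (t₀ + τ)) := by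
    intro u hu hbox huτ
    obtain ⟨h1, h2, h3, h4⟩ := (step (t₀ + τ) ⟨by linarith, huτ.trans hu.2⟩
      (fun v hv => hbox v ⟨hv.1, hv.2.trans huτ⟩)).2.1 le_rfl
    exact hrod K (by rw [← hK]) (by rw [← hK]) (by rw [← hK]) (by rw [← hK]) C s d _
      (t₀ + τ) u hs hd (by linarith) (Set.Icc_subset_Icc (by linarith) hu.2)
      (fun j v hv => (step u hu hbox).2.2 v ⟨by linarith [hv.1], hv.2⟩ hv.1 j) h1 h2 h3 h4 u
      ⟨huτ, le_rfl⟩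
  have hbox : ∀ u ∈ Set.Icc t₀ t₁, rodSize r s u < R := by
    have hnear : ∀ u, ‖ex r s u‖ ≤ D.ex + 1 → ‖ev r s u‖ ≤ D.ev + 1 → ‖eωr r s u‖ ≤ D.eωr + 1 →
        rodSize r s u < R := fun u h1 h2 h3 => by
      have e1 : ‖ex r s u‖ ^ 2 ≤ (D.ex + 1) ^ 2 := by gcongr
      have e2 : ‖ev r s u‖ ^ 2 ≤ (D.ev + 1) ^ 2 := by gcongr
      have e3 : ‖eωr r s u‖ ^ 2 ≤ (D.eωr + 1) ^ 2 := by gcongr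
      unfold rodSize
      linarith
    -- Up to `t₀ + τ` the drift bound keeps the errors strictly inside the ball, later the envelopes
    -- do.
    refine lt_of_continuousOn_of_bootstrap hs.continuousOn_rodSize
      (hnear t₀ (by linarith) (by linarith) (by linarith)) (fun u hu hle => ?_)
    rcases le_total u (t₀ + τ) with huτ | huτ
    · obtain ⟨h1, h2, h3, -⟩ := (step u hu hle).2.1 huτ
      exact hnear u h1 h2 h3
    · obtain ⟨h1, h2⟩ := late u hu hle huτ
      have e1 := h1.trans (envelope_le hκx hk (by linarith))
      have e2 := h2.trans (envelope_le hκq hk (by linarith))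
      have e3 : ‖ex r s u‖ ^ 2 ≤ k ^ 2 * ‖ex r s u‖ ^ 2 :=
        le_mul_of_one_le_left (sq_nonneg _) (one_le_pow₀ hk)
      have e4 : 0 ≤ k ^ 2 * ‖eqr r s u‖ ^ 2 := by positivity
      unfold rodSize
      linarith
  have htI : t ∈ Set.Icc t₀ t₁ := ⟨by linarith [ht.1], ht.2⟩
  have hbox' : ∀ v ∈ Set.Icc t₀ t, rodSize r s v ≤ R := fun v hv =>
    (hbox v ⟨hv.1, hv.2.trans ht.2⟩).le
  obtain ⟨h1, h2⟩ := late t htI hbox' (by linarith [ht.1])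
  refine errNorm_le hb hk hkc (h1.trans (hTx _ (by linarith [ht.1])))
    (h2.trans (hTq _ (by linarith [ht.1]))) (fun j => ((step t htI hbox').1 j).trans (hTc j _ ?_))
  fin_cases j
  · simp only [Fin.zero_eta]; linarith [ht.1]
  · simp only [Fin.mk_one]; linarith [ht.1]

end RodTransport

end

open RodTransport in
theorem theorem5p1 (p : Params) (r : Reference) (δ : DistBound) (D : DomainBound) :
    ∃ αmax : ℝ, 0 < αmax ∧
      ∀ ψ : Fin 2 → ℝ, (∀ j, 0 < ψ j ∧ ψ j < 1) → cableSize ψ < αmax →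
        ∀ b : ℝ, 0 < b → ∃ K : RodGains, ∀ m₀ : ℝ, 0 < m₀ → ∃ C : CableGains,
          UniformlyUltimatelyBounded p K C r δ D ψ m₀ b := by
  -- For `ψ j` in `(0, 1)` the number `cableSize ψ` is always below 2.
  exact ⟨2, two_pos, fun ψ hψ _ b hb =>
    exists_gains_uniformlyUltimatelyBounded p r δ D ψ hψ b hb⟩
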